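/- **Theorem (Second Restriction Theorem).** For a finite-dimensional real vector space $V$ put $\mathbf J^2(V)=\mathbb R\times V^*\times \mathrm{Sym}^2(V^*)$, with elements $(r,p,A)$. A set $\mathbf F\subset\mathbf J^2(V)$ is a *constant coefficient subequation* if it is closed and satisfies (P): $(r,p,A)\in\mathbf F$ and $P\ge 0$ imply $(r,p,A+P)\in\mathbf F$. For a smooth manifold $M$ let $J^2(M)$ be the bundle of 2-jets of functions; local coordinates on $U\subset M$ with values in $V$ trivialize it as $J^2(U)=U\times\mathbf J^2(V)$ via $J_xu\mapsto(u,Du,D^2u)(x)$. A *subequation* on $M$ is a closed set $F\subset J^2(M)$ whose fibres satisfy (P). An upper semicontinuous $u:M\to[-\infty,\infty)$ is *$F$-subharmonic* if for every $x_0\in M$ and every function $\varphi$ that is $C^2$ near $x_0$ with $u\le\varphi$ near $x_0$ and $u(x_0)=\varphi(x_0)$, the 2-jet of $\varphi$ at $x_0$ lies in $F$. An *automorphism* of $J^2(U)$ is a smooth vector bundle isomorphism $\Phi$ that is the identity on the 0-jet factor $\mathbb R$ times an isomorphism of the reduced jet bundle which maps the subbundle $\mathrm{Sym}^2(T^*U)$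 to itself by $\Phi(A)=hAh^t$ for some smooth bundle isomorphism $h$ of $T^*U$. A subequation $F$ on $M$ is *locally jet equivalent to* the constant coefficient subequation $\mathbf F$ if each point of $M$ has a coordinate neighbourhood $U$ and an automorphism $\Phi$ of $J^2(U)$ with $\Phi(F|_U)=U\times\mathbf F$ in those coordinates. Let $i:X\hookrightarrow Z$ be an embedded submanifold of a smooth manifold, $\dim X=n$, $\dim Z=n+m$, and let $i_X^*:J^2_{i(x)}(Z)\to J^2_x(X)$ be the restriction of 2-jets, $J_{i(x)}f\mapsto J_x(f\circ i)$. In coordinates it is modelled by $i^*:\mathbf J^2(\mathbb R^n\times\mathbb R^m)\to\mathbf J^2(\mathbb R^n)$, $$i^*\left(r,(p,q),\begin{pmatrix}A&C\\ C^t&B\end{pmatrix}\right)=(r,p,A).$$ A subequation $F\subset J^2(Z)$ is *locally jet equivalent modulo $X$ to* the constant coefficient subequation $\mathbf F\subset\mathbf J^2(\mathbb R^n\times\mathbb R^m)$ if each point of $X$ has a neighbourhood $U$ in $Z$ with coordinates $z=(x,y)\in\mathbb R^n\times\mathbb R^m$ in which $X\cap U=\{y=y_0\}$, and an automorphism $\Phi$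 of $J^2(U)$ with $\Phi(F|_U)=U\times\mathbf F$ in those coordinates, such that over $X\cap U$ one has $i^*\circ\Phi=\varphi\circ i^*$ for some automorphism $\varphi$ of $J^2(X\cap U)$. Suppose the subequation $F\subset J^2(Z)$ is locally jet equivalent modulo $X$ to a constant coefficient subequation $\mathbf F\subset\mathbf J^2(\mathbb R^n\times\mathbb R^m)$, and suppose that $\mathbf H=i^*\mathbf F$ is a closed set. Let $H=i_X^*F\subset J^2(X)$, that is, $H_x=i_X^*(F_{i(x)})$ for $x\in X$. Then $\mathbf H$ is a constant coefficient subequation, $H$ is a subequation on $X$, $H$ is locally jet equivalent to $\mathbf H$, and restriction holds: for every $F$-subharmonic function $u$ on $Z$, the restriction $u|_X$ is $H$-subharmonic on $X$. -/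

import Mathlib

open scoped Manifold ContDiff Topology

noncomputable section

namespace JetRestriction

/-! ### The model fibre of the 2-jet bundle -/

section Model

variable {V W : Type*} [NormedAddCommGroup V] [NormedSpace ℝ V]
  [NormedAddCommGroup W] [NormedSpace ℝ W]

/-- The symmetric bilinear forms, as a subspace of all bilinear forms on `V`. -/
def symSubmodule (V : Type*) [NormedAddCommGroup V] [NormedSpace ℝ V] :
    @Submodule ℝ (V →L[ℝ] V →L[ℝ] ℝ) _ NormedAddCommGroup.toAddCommGroup.toAddCommMonoid
      NormedSpace.toModule where
  carrier := {A | ∀ v w, A v w = A w v}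
  add_mem' := fun {A B} hA hB v w => by
    change A v w + B v w = A w v + B w v
    rw [hA v w, hB v w]
  zero_mem' := fun v w => rfl
  smul_mem' := fun c A hA v w => by
    change c * A v w = c * A w v
    rw [hA v w]

/-- `Sym²(V*)`: the normed space of symmetric bilinear forms on `V`. -/
def SymForm (V : Type*) [NormedAddCommGroup V] [NormedSpace ℝ V] : Type _ := ↥(symSubmodule V)

instance SymForm.instNormedAddCommGroup : NormedAddCommGroup (SymForm V) :=
  inferInstanceAs (NormedAddCommGroup ↥(symSubmodule V))

instance SymForm.instNormedSpace : NormedSpace ℝ (SymForm V) :=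
  inferInstanceAs (NormedSpace ℝ ↥(symSubmodule V))

/-- The bilinear form underlying an element of `Sym²(V*)`. -/
def SymForm.form : SymForm V →L[ℝ] V →L[ℝ] V →L[ℝ] ℝ := (symSubmodule V).subtypeL

/-- Pull-back of a symmetric form along a linear map: `(ℓ* A)(v, w) = A (ℓ v, ℓ w)`. -/
def SymForm.pull (ℓ : V →L[ℝ] W) (A : SymForm W) : SymForm V :=
  (⟨A.form.bilinearComp ℓ ℓ, fun v w => A.2 (ℓ v) (ℓ w)⟩ : ↥(symSubmodule V))

/-- `A ≥ 0` as a quadratic form. -/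
def SymForm.IsNonneg (A : SymForm V) : Prop := ∀ v, 0 ≤ A.form v v

/-- The reduced 2-jets `(p, A)` with constant coefficients, `V* × Sym²(V*)`. -/
abbrev RedJet (V : Type*) [NormedAddCommGroup V] [NormedSpace ℝ V] : Type _ :=
  (V →L[ℝ] ℝ) × SymForm V

/-- The space `𝐉²(V) = ℝ × V* × Sym²(V*)` of 2-jets `(r, p, A)`. -/
abbrev JetModel (V : Type*) [NormedAddCommGroup V] [NormedSpace ℝ V] : Type _ :=
  ℝ × RedJet V

/-- The positivity condition (P) on a set of jets: `S + 𝒫 ⊆ S`. -/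
def PosCondition (S : Set (JetModel V)) : Prop :=
  ∀ (r : ℝ) (p : V →L[ℝ] ℝ) (A P : SymForm V),
    (r, p, A) ∈ S → P.IsNonneg → (r, p, A + P) ∈ S

/-- A constant coefficient subequation: a closed set of jets satisfying (P). -/
def IsConstSubequation (S : Set (JetModel V)) : Prop :=
  IsClosed S ∧ PosCondition S

/-- Restriction of 2-jets from `V × W` to the `V`-directions:
`i* (r, (p, q), (A, C; Cᵗ, B)) = (r, p, A)`. -/
def restrictModel (J : JetModel (V × W)) : JetModel V :=
  (J.1, J.2.1.comp (ContinuousLinearMap.inl ℝ V W),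
    J.2.2.pull (ContinuousLinearMap.inl ℝ V W))

/-- The fibrewise action on full jets `(r, j)` of an automorphism of reduced jets: it is the
identity on the 0-jet factor. -/
def actJet (Φ : RedJet V ≃L[ℝ] RedJet V) (J : JetModel V) : JetModel V :=
  (J.1, Φ J.2)

/-- A (smooth) automorphism of the jet bundle over the open set `D ⊆ V`, where the bundle of reduced
jets is canonically trivialised as `D × RedJet V`: a smooth family of linear isomorphisms `Φ x` that
map the subbundle `Sym²` to itself through a smooth bundle isomorphism `h` of the cotangent bundle,
`Φ x A = h A hᵗ`, i.e. `(Φ x A)(v, w) = A (hᵗ v, hᵗ w)`.  The family `k` below is `hᵗ`. -/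
def IsJetAutomorphism (D : Set V) (Φ : V → RedJet V ≃L[ℝ] RedJet V) : Prop :=
  ContDiffOn ℝ ∞ (fun x => (Φ x : RedJet V →L[ℝ] RedJet V)) D ∧
  ∃ k : V → V ≃L[ℝ] V,
    ContDiffOn ℝ ∞ (fun x => (k x : V →L[ℝ] V)) D ∧
    ∀ x ∈ D, ∀ A : SymForm V, Φ x (0, A) = (0, A.pull (k x : V →L[ℝ] V))

/-- An automorphism `Φ` over the open set `D ⊆ V × W` is a relative automorphism with respect to
the slice `{y = y₀}` if on the slice it covers, via restriction of jets, an automorphism `φ` of the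
jet bundle of the slice: `i* ∘ Φ = φ ∘ i*`. -/
def IsRelativeJetAutomorphism (D : Set (V × W)) (y₀ : W)
    (Φ : V × W → RedJet (V × W) ≃L[ℝ] RedJet (V × W)) : Prop :=
  IsJetAutomorphism D Φ ∧
  ∃ φ : V → RedJet V ≃L[ℝ] RedJet V,
    IsJetAutomorphism {x | (x, y₀) ∈ D} φ ∧
    ∀ x, (x, y₀) ∈ D → ∀ J : JetModel (V × W),
      restrictModel (actJet (Φ (x, y₀)) J) = actJet (φ x) (restrictModel J)

theorem two_le_infty : (2 : WithTop ℕ∞) ≤ ∞ := by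
  have h : ((2 : ℕ∞) : WithTop ℕ∞) ≤ ((⊤ : ℕ∞) : WithTop ℕ∞) := WithTop.coe_le_coe.2 le_top
  exact h

/-- Value, first and second derivative of `f` at `x`. -/
def derivs (f : V → ℝ) (x : V) : ℝ × (V →L[ℝ] ℝ) × (V →L[ℝ] V →L[ℝ] ℝ) :=
  (f x, fderiv ℝ f x, fderiv ℝ (fderiv ℝ f) x)

theorem derivs_congr {f g : V → ℝ} {x : V} (h : f =ᶠ[𝓝 x] g) : derivs f x = derivs g x := by
  simp only [derivs, h.eq_of_nhds, h.fderiv_eq, h.fderiv.fderiv_eq]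

/-- Chain rule: the derivatives up to order two of `f ∘ τ` depend only on those of `f`. -/
theorem derivs_comp {f g : W → ℝ} {τ : V → W} {x : V}
    (hf : ContDiffAt ℝ 2 f (τ x)) (hg : ContDiffAt ℝ 2 g (τ x)) (hτ : ContDiffAt ℝ 2 τ x)
    (h : derivs f (τ x) = derivs g (τ x)) : derivs (f ∘ τ) x = derivs (g ∘ τ) x := by
  have key : ∀ {f : W → ℝ}, ContDiffAt ℝ 2 f (τ x) →
      fderiv ℝ (f ∘ τ) x = (fderiv ℝ f (τ x)).comp (fderiv ℝ τ x) ∧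
      fderiv ℝ (fderiv ℝ (f ∘ τ)) x =
        (ContinuousLinearMap.compL ℝ V W ℝ (fderiv ℝ f (τ x))).comp (fderiv ℝ (fderiv ℝ τ) x) +
        ((ContinuousLinearMap.compL ℝ V W ℝ).flip (fderiv ℝ τ x)).comp
          ((fderiv ℝ (fderiv ℝ f) (τ x)).comp (fderiv ℝ τ x)) := by
    intro f hf
    have h1 : ∀ᶠ y in 𝓝 x, fderiv ℝ (f ∘ τ) y = (fderiv ℝ f (τ y)).comp (fderiv ℝ τ y) := by
      have hf1 : ∀ᶠ z in 𝓝 (τ x), ContDiffAt ℝ 2 f z := hf.eventually (by simp)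
      filter_upwards [hτ.eventually (by simp), hτ.continuousAt.eventually hf1] with y hy hy'
      exact fderiv_comp y (hy'.differentiableAt (by simp)) (hy.differentiableAt (by simp))
    refine ⟨h1.self_of_nhds, ?_⟩
    have h1' : fderiv ℝ (f ∘ τ) =ᶠ[𝓝 x] fun y => (fderiv ℝ f (τ y)).comp (fderiv ℝ τ y) := h1
    rw [h1'.fderiv_eq]
    have hdf : DifferentiableAt ℝ (fderiv ℝ f) (τ x) :=
      (hf.fderiv_right (m := 1) (by norm_num)).differentiableAt (by simp)
    have hdτ : DifferentiableAt ℝ (fderiv ℝ τ) x :=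
      (hτ.fderiv_right (m := 1) (by norm_num)).differentiableAt (by simp)
    have hc : HasFDerivAt (fun y => fderiv ℝ f (τ y))
        ((fderiv ℝ (fderiv ℝ f) (τ x)).comp (fderiv ℝ τ x)) x :=
      hdf.hasFDerivAt.comp x (hτ.differentiableAt (by simp)).hasFDerivAt
    exact (hc.clm_comp hdτ.hasFDerivAt).fderiv
  simp only [derivs, Prod.mk.injEq] at h ⊢
  obtain ⟨h0, h1, h2⟩ := h
  obtain ⟨a1, a2⟩ := key hf
  obtain ⟨b1, b2⟩ := key hg
  refine ⟨h0, ?_, ?_⟩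
  · rw [a1, b1, h1]
  · rw [a2, b2, h1, h2]

end Model

/-! ### The 2-jet bundle of a manifold -/

section Jets

variable (E : Type*) [NormedAddCommGroup E] [NormedSpace ℝ E]
  {M : Type*} [TopologicalSpace M] [ChartedSpace E M]

/-- Functions of class `C²` near `z`. -/
def C2At (z : M) : Type _ := {f : M → ℝ // ContMDiffAt 𝓘(ℝ, E) 𝓘(ℝ, ℝ) 2 f z}

/-- Two functions have the same 2-jet at `z` if their value, first and second derivatives at `z`
agree in a chart (by the chain rule the chart is irrelevant). -/
def jetSetoid (z : M) : Setoid (C2At E z) where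
  r f g := derivs (f.1 ∘ (chartAt E z).symm) (chartAt E z z) =
    derivs (g.1 ∘ (chartAt E z).symm) (chartAt E z z)
  iseqv := ⟨fun _ => rfl, fun h => h.symm, fun h h' => h.trans h'⟩

/-- The fibre `J²_z(M)`: 2-jets at `z` of functions that are `C²` near `z`. -/
def Jet (z : M) : Type _ := Quotient (jetSetoid E z)

variable (M) in
/-- The total space of the 2-jet bundle `J²(M)`. -/
def JetBundle : Type _ := Σ z : M, Jet E z

/-- The 2-jet at `z` of a function of class `C²` near `z`. -/
def jet (f : M → ℝ) (z : M) (hf : ContMDiffAt 𝓘(ℝ, E) 𝓘(ℝ, ℝ) 2 f z) : JetBundle E M :=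
  ⟨z, Quotient.mk (jetSetoid E z) ⟨f, hf⟩⟩

variable (M) in
/-- A smooth local coordinate system on `M` with values in `V`: a diffeomorphism of an open subset
of `M` onto an open subset of `V`. -/
structure LocalCoord (V : Type*) [NormedAddCommGroup V] [NormedSpace ℝ V] where
  /-- the coordinate map -/
  toHomeo : OpenPartialHomeomorph M V
  smooth : ContMDiffOn 𝓘(ℝ, E) 𝓘(ℝ, V) ∞ toHomeo toHomeo.source
  smooth_symm : ContMDiffOn 𝓘(ℝ, V) 𝓘(ℝ, E) ∞ toHomeo.symm toHomeo.target

variable {E} {V : Type*} [NormedAddCommGroup V] [NormedSpace ℝ V]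

/-- The quadratic polynomial on `V` with 2-jet `J` at `x`. -/
def quadPoly (x : V) (J : JetModel V) (v : V) : ℝ :=
  J.1 + J.2.1 (v - x) + (1 / 2) * J.2.2.form (v - x) (v - x)

theorem quadPoly_contDiff (x : V) (J : JetModel V) : ContDiff ℝ ∞ (quadPoly x J) := by
  unfold quadPoly
  have h : ContDiff ℝ ∞ (fun v : V => v - x) := contDiff_id.sub contDiff_const
  exact (contDiff_const.add (J.2.1.contDiff.comp h)).add
    (contDiff_const.mul ((J.2.2.form.contDiff.comp h).clm_apply h))

theorem LocalCoord.contMDiffAt_quadPoly (e : LocalCoord E M V) (x : e.toHomeo.target)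
    (J : JetModel V) :
    ContMDiffAt 𝓘(ℝ, E) 𝓘(ℝ, ℝ) 2 (quadPoly (x : V) J ∘ e.toHomeo) (e.toHomeo.symm x) := by
  have h1 : ContMDiffAt 𝓘(ℝ, E) 𝓘(ℝ, V) ∞ e.toHomeo (e.toHomeo.symm x) :=
    e.smooth.contMDiffAt (e.toHomeo.open_source.mem_nhds (e.toHomeo.map_target x.2))
  have h2 : ContMDiffAt 𝓘(ℝ, V) 𝓘(ℝ, ℝ) ∞ (quadPoly (x : V) J)
      (e.toHomeo (e.toHomeo.symm x)) := (quadPoly_contDiff (x : V) J).contMDiff.contMDiffAt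
  exact (h2.comp _ h1).of_le two_le_infty

/-- The canonical trivialisation of the jet bundle over a coordinate domain `U`: the jet over the
point with coordinates `x` whose coordinate expression `(u, Du, D²u)` at `x` is `J`. -/
def LocalCoord.jetOf (e : LocalCoord E M V) (x : e.toHomeo.target) (J : JetModel V) :
    JetBundle E M :=
  jet E (quadPoly (x : V) J ∘ e.toHomeo) (e.toHomeo.symm x) (e.contMDiffAt_quadPoly x J)

/-- The topology of `J²(M)`: the final topology for the canonical trivialisations
`e(U) × 𝐉²(E) → J²(M)` over all coordinate systems. -/
instance JetBundle.instTopologicalSpace : TopologicalSpace (JetBundle E M) :=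
  ⨆ e : LocalCoord E M E,
    TopologicalSpace.coinduced
      (fun q : e.toHomeo.target × JetModel E => e.jetOf q.1 q.2) inferInstance

/-- The coordinate expression, at the point with coordinates `x`, of the fibre of `F ⊆ J²(M)`. -/
def fibre (F : Set (JetBundle E M)) (e : LocalCoord E M V) (x : e.toHomeo.target) :
    Set (JetModel V) :=
  {J | e.jetOf x J ∈ F}

/-- A subequation on `M`: a closed subset of `J²(M)` all of whose fibres satisfy (P). -/
def IsSubequation (F : Set (JetBundle E M)) : Prop :=
  IsClosed F ∧ ∀ (e : LocalCoord E M E) (x : e.toHomeo.target), PosCondition (fibre F e x)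

/-- `u` is `F`-subharmonic: `u` is upper semicontinuous with values in `[-∞, ∞)`, and the 2-jet at
`z` of every test function for `u` at `z` belongs to `F`, for all `z`. -/
def IsSubharmonic (F : Set (JetBundle E M)) (u : M → EReal) : Prop :=
  UpperSemicontinuous u ∧ (∀ z, u z < ⊤) ∧
  ∀ (z : M) (φ : M → ℝ) (hφ : ContMDiffAt 𝓘(ℝ, E) 𝓘(ℝ, ℝ) 2 φ z),
    (∀ᶠ w in 𝓝 z, u w ≤ (φ w : EReal)) → u z = (φ z : EReal) → jet E φ z hφ ∈ F

/-- `F` is locally jet equivalent to the constant coefficient subequation `S`: every point has a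
coordinate neighbourhood `U` and an automorphism of `J²(U)` carrying `F` over `U` to `U × S`. -/
def LocallyJetEquivalent (F : Set (JetBundle E M)) (S : Set (JetModel V)) : Prop :=
  ∀ z : M, ∃ e : LocalCoord E M V, z ∈ e.toHomeo.source ∧
    ∃ Φ : V → RedJet V ≃L[ℝ] RedJet V, IsJetAutomorphism e.toHomeo.target Φ ∧
      ∀ (x : e.toHomeo.target) (J : JetModel V), J ∈ fibre F e x ↔ actJet (Φ x) J ∈ S

end Jets

/-! ### Restriction to a submanifold -/

section Restriction

variable {E₁ E₂ : Type*} [NormedAddCommGroup E₁] [NormedSpace ℝ E₁]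
  [NormedAddCommGroup E₂] [NormedSpace ℝ E₂]
  {X Z : Type*} [TopologicalSpace X] [ChartedSpace E₁ X] [TopologicalSpace Z] [ChartedSpace E₂ Z]

theorem derivs_pullback [IsManifold 𝓘(ℝ, E₁) ∞ X] [IsManifold 𝓘(ℝ, E₂) ∞ Z] {i : X → Z}
    (hi : ContMDiff 𝓘(ℝ, E₁) 𝓘(ℝ, E₂) ∞ i) (x : X) {f g : Z → ℝ}
    (hf : ContMDiffAt 𝓘(ℝ, E₂) 𝓘(ℝ, ℝ) 2 f (i x)) (hg : ContMDiffAt 𝓘(ℝ, E₂) 𝓘(ℝ, ℝ) 2 g (i x))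
    (h : derivs (f ∘ (chartAt E₂ (i x)).symm) (chartAt E₂ (i x) (i x)) =
      derivs (g ∘ (chartAt E₂ (i x)).symm) (chartAt E₂ (i x) (i x))) :
    derivs ((f ∘ i) ∘ (chartAt E₁ x).symm) (chartAt E₁ x x) =
      derivs ((g ∘ i) ∘ (chartAt E₁ x).symm) (chartAt E₁ x x) := by
  set c := chartAt E₁ x
  set d := chartAt E₂ (i x)
  set τ : E₁ → E₂ := d ∘ i ∘ c.symm with hτdef
  have hx : c.symm (c x) = x := c.left_inv (mem_chart_source E₁ x)
  have hτx : τ (c x) = d (i x) := by simp [hτdef, hx]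
  have hτ : ContDiffAt ℝ 2 τ (c x) := by
    have h' : ContDiffAt ℝ ∞ τ (c x) := by
      rw [← contDiffWithinAt_univ]
      simpa [extChartAt, τ, c, d] using (contMDiffAt_iff.1 (hi x)).2
    exact h'.of_le two_le_infty
  have chart : ∀ {k : Z → ℝ}, ContMDiffAt 𝓘(ℝ, E₂) 𝓘(ℝ, ℝ) 2 k (i x) →
      ContDiffAt ℝ 2 (k ∘ d.symm) (τ (c x)) := by
    intro k hk
    rw [hτx, ← contDiffWithinAt_univ]
    simpa [extChartAt, chartAt_self_eq, d] using (contMDiffAt_iff.1 hk).2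
  have ev : ∀ k : Z → ℝ, (k ∘ i) ∘ c.symm =ᶠ[𝓝 (c x)] (k ∘ d.symm) ∘ τ := by
    intro k
    have hc : ContinuousAt (i ∘ c.symm) (c x) := by
      refine ContinuousAt.comp hi.continuous.continuousAt ?_
      exact c.continuousAt_symm (c.map_source (mem_chart_source E₁ x))
    have hmem : ∀ᶠ y in 𝓝 (c x), (i ∘ c.symm) y ∈ d.source := by
      refine hc.eventually (d.open_source.mem_nhds ?_)
      simp only [Function.comp_apply, hx]
      exact mem_chart_source E₂ (i x)
    filter_upwards [hmem] with y hy
    simp only [Function.comp_apply, hτdef] at hy ⊢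
    rw [d.left_inv hy]
  rw [derivs_congr (ev f), derivs_congr (ev g)]
  exact derivs_comp (chart hf) (chart hg) hτ (by rw [hτx]; exact h)

/-- Restriction of 2-jets, `i* : J²_{i(x)}(Z) → J²_x(X)`, induced by `f ↦ f ∘ i`. -/
def pullJet [IsManifold 𝓘(ℝ, E₁) ∞ X] [IsManifold 𝓘(ℝ, E₂) ∞ Z] (i : X → Z)
    (hi : ContMDiff 𝓘(ℝ, E₁) 𝓘(ℝ, E₂) ∞ i) (x : X) : Jet E₂ (i x) → Jet E₁ x :=
  Quotient.map' (s₁ := jetSetoid E₂ (i x)) (s₂ := jetSetoid E₁ x)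
    (fun f => ⟨f.1 ∘ i, f.2.comp x ((hi x).of_le two_le_infty)⟩)
    (fun f g h => derivs_pullback hi x f.2 g.2 h)

/-- The restriction `H = i* F` of `F ⊆ J²(Z)` to `X`: `H_x = i* (F_{i(x)})`. -/
def restrictSet [IsManifold 𝓘(ℝ, E₁) ∞ X] [IsManifold 𝓘(ℝ, E₂) ∞ Z] (i : X → Z)
    (hi : ContMDiff 𝓘(ℝ, E₁) 𝓘(ℝ, E₂) ∞ i) (F : Set (JetBundle E₂ Z)) : Set (JetBundle E₁ X) :=
  {q | ∃ j : Jet E₂ (i q.1), (⟨i q.1, j⟩ : JetBundle E₂ Z) ∈ F ∧ pullJet i hi q.1 j = q.2}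

variable {V W : Type*} [NormedAddCommGroup V] [NormedSpace ℝ V]
  [NormedAddCommGroup W] [NormedSpace ℝ W]

/-- Coordinates `z = (x, y)` on `U ⊆ Z` are adapted to `X` if `X ∩ U = {y = y₀}`. -/
def IsAdapted (i : X → Z) (e : LocalCoord E₂ Z (V × W)) (y₀ : W) : Prop :=
  ∀ z ∈ e.toHomeo.source, z ∈ Set.range i ↔ (e.toHomeo z).2 = y₀

/-- `F ⊆ J²(Z)` is locally jet equivalent modulo `X` to the constant coefficient subequation `S`:
every point of `X` has an adapted coordinate neighbourhood `U` in `Z` and a relative automorphism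
of `J²(U)` with respect to `X ∩ U` carrying `F` over `U` to `U × S`. -/
def LocallyJetEquivalentModulo (i : X → Z) (F : Set (JetBundle E₂ Z))
    (S : Set (JetModel (V × W))) : Prop :=
  ∀ x₀ : X, ∃ (e : LocalCoord E₂ Z (V × W)) (y₀ : W),
    i x₀ ∈ e.toHomeo.source ∧ IsAdapted i e y₀ ∧
    ∃ Φ : V × W → RedJet (V × W) ≃L[ℝ] RedJet (V × W),
      IsRelativeJetAutomorphism e.toHomeo.target y₀ Φ ∧
      ∀ (z : e.toHomeo.target) (J : JetModel (V × W)),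
        J ∈ fibre F e z ↔ actJet (Φ z) J ∈ S

end Restriction

end JetRestriction

end

/-! The structural claims come from adapted coordinates. There `i` becomes `v ↦ (v, y₀)`, so
restriction of jets is exactly the linear map `i*` of the model. Since `i* ∘ Φ = φ ∘ i*` on the
slice and `Φ`, `φ` are invertible, `φ` carries `H` to `i* S`
(`IsAdapted.mem_fibre_restrictSet_iff`). Closedness and (P) are then inherited from `i* S`
(`LocallyJetEquivalent.isSubequation`), which itself satisfies (P) because a nonnegative form on the
slice extends to a nonnegative form on the ambient space.

Restriction is a penalization argument. Let `f` be a test function for `u` on the slice at `x₀`.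
Adding `|x - x₀|⁴` makes the contact strict and leaves the 2-jet at `x₀` unchanged; call the result
`g`. Near `(x₀, y₀)` maximize `u - g(x) - N|y - y₀|²`. Along a sequence of `N` the maximum points
`z` tend to `(x₀, y₀)`, with `N|y - y₀|² → 0` and `u(z) → g(x₀)` (`exists_seq_penalized_max`). At
each such point the shifted penalized function is a test function for `u`, so `i* Φ` of its jet lies
in `i* S`. That set is closed, so it remains to show that these jets converge to `φ(x₀)` applied to
the jet of `f`.

The part of the jet coming from `g` converges by continuity. The penalty contributes `2N (⟨y - y₀,
·⟩, |dy|²)`, with `N` possibly unbounded, and its image must tend to `0` (`tendsto_restrictRed`).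
The first-order part has size `|y - y₀|` and is killed by `i* Φ` on the slice, so a Lipschitz bound
gives `O(N|y - y₀|²)`. For the second-order part, vanishing on the slice alone would give only
`O(N|y - y₀|)`. Here the form `A ↦ h A hᵗ` of the automorphism is decisive: the image of `|dy|²` is
`|T·|²`, where `T` is the block of `hᵗ` from slice to normal directions. On the slice `T = 0`, so `T
= O(|y - y₀|)`, and squaring gives `O(N|y - y₀|²)` again. -/

noncomputable section

namespace JetRestriction

/-! ### Symmetric forms: pull-back, symmetrization, restriction. -/

section Forms

variable {V W : Type*} [NormedAddCommGroup V] [NormedSpace ℝ V]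
  [NormedAddCommGroup W] [NormedSpace ℝ W]

theorem SymForm.ext_form {A B : SymForm V} (h : A.form = B.form) : A = B :=
  Subtype.ext h

theorem SymForm.form_symm (A : SymForm V) (v w : V) : A.form v w = A.form w v :=
  A.2 v w

theorem SymForm.norm_form (A : SymForm V) : ‖A.form‖ = ‖A‖ := rfl

theorem SymForm.pull_form (ℓ : V →L[ℝ] W) (A : SymForm W) (v w : V) :
    (A.pull ℓ).form v w = A.form (ℓ v) (ℓ w) := rfl

theorem SymForm.norm_pull_le (ℓ : V →L[ℝ] W) (A : SymForm W) :
    ‖A.pull ℓ‖ ≤ ‖ℓ‖ ^ 2 * ‖A‖ := by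
  rw [← SymForm.norm_form, ← SymForm.norm_form]
  refine ContinuousLinearMap.opNorm_le_bound₂ _ (by positivity) fun v w => ?_
  rw [SymForm.pull_form]
  calc ‖A.form (ℓ v) (ℓ w)‖ ≤ ‖A.form‖ * ‖ℓ v‖ * ‖ℓ w‖ := A.form.le_opNorm₂ _ _
    _ ≤ ‖A.form‖ * (‖ℓ‖ * ‖v‖) * (‖ℓ‖ * ‖w‖) := by gcongr <;> exact ℓ.le_opNorm _
    _ = ‖ℓ‖ ^ 2 * ‖A.form‖ * ‖v‖ * ‖w‖ := by ring

/-- Pull-back along `ℓ` as a continuous linear map. -/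
def SymForm.pullL (ℓ : V →L[ℝ] W) : SymForm W →L[ℝ] SymForm V :=
  LinearMap.mkContinuous
    { toFun := SymForm.pull ℓ
      map_add' := fun _ _ => rfl
      map_smul' := fun _ _ => rfl } (‖ℓ‖ ^ 2) (SymForm.norm_pull_le ℓ)

theorem SymForm.pullL_apply (ℓ : V →L[ℝ] W) (A : SymForm W) : SymForm.pullL ℓ A = A.pull ℓ := rfl

/-- The symmetric part of a bilinear form. -/
def symPart (B : V →L[ℝ] V →L[ℝ] ℝ) : SymForm V :=
  (⟨(1 / 2 : ℝ) • (B + B.flip), fun v w => by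
    change (1 / 2 : ℝ) * (B v w + B w v) = (1 / 2 : ℝ) * (B w v + B v w)
    ring⟩ : ↥(symSubmodule V))

theorem norm_symPart_le (B : V →L[ℝ] V →L[ℝ] ℝ) : ‖symPart B‖ ≤ 1 * ‖B‖ := by
  rw [← SymForm.norm_form]
  refine ContinuousLinearMap.opNorm_le_bound₂ _ (by positivity) fun v w => ?_
  change |(1 / 2 : ℝ) * (B v w + B w v)| ≤ 1 * ‖B‖ * ‖v‖ * ‖w‖
  have h1 := abs_le.1 (B.le_opNorm₂ v w)
  have h2 := abs_le.1 (B.le_opNorm₂ w v)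
  rw [abs_le]
  constructor <;> nlinarith [h1.1, h1.2, h2.1, h2.2]

/-- The symmetric part of a bilinear form, as a continuous linear map. -/
def symmetrize : (V →L[ℝ] V →L[ℝ] ℝ) →L[ℝ] SymForm V :=
  LinearMap.mkContinuous
    { toFun := symPart
      map_add' := fun B C => by
        refine SymForm.ext_form ?_
        ext v w
        change (1 / 2 : ℝ) * (B v w + C v w + (B w v + C w v)) =
          (1 / 2 : ℝ) * (B v w + B w v) + (1 / 2 : ℝ) * (C v w + C w v)
        ring
      map_smul' := fun c B => by
        refine SymForm.ext_form ?_
        ext v w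
        change (1 / 2 : ℝ) * (c * B v w + c * B w v) = c * ((1 / 2 : ℝ) * (B v w + B w v))
        ring } 1 norm_symPart_le

theorem symmetrize_form_apply (B : V →L[ℝ] V →L[ℝ] ℝ) (v w : V) :
    (symmetrize B).form v w = (1 / 2 : ℝ) * (B v w + B w v) := rfl

theorem symmetrize_form (A : SymForm V) : symmetrize A.form = A := by
  refine SymForm.ext_form ?_
  ext v w
  rw [symmetrize_form_apply, A.form_symm w v]
  ring

theorem form_symmetrize {B : V →L[ℝ] V →L[ℝ] ℝ} (h : ∀ v w, B v w = B w v) :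
    (symmetrize B).form = B := by
  ext v w
  rw [symmetrize_form_apply, h w v]
  ring

/-- The restriction of reduced jets to the `V`-directions. -/
def restrictRed : RedJet (V × W) →L[ℝ] RedJet V :=
  ((ContinuousLinearMap.compL ℝ V (V × W) ℝ).flip (ContinuousLinearMap.inl ℝ V W)).prodMap
    (SymForm.pullL (ContinuousLinearMap.inl ℝ V W))

theorem restrictModel_eq (J : JetModel (V × W)) : restrictModel J = (J.1, restrictRed J.2) := rfl

theorem restrictRed_apply (p : V × W →L[ℝ] ℝ) (A : SymForm (V × W)) :
    restrictRed (p, A) = (p.comp (ContinuousLinearMap.inl ℝ V W),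
      A.pull (ContinuousLinearMap.inl ℝ V W)) := rfl

/-- A nonnegative form on `V` extends to `V × W` by pull-back along the projection. The extension is
still nonnegative and restricts to the original form. -/
theorem PosCondition.restrictModel {S : Set (JetModel (V × W))} (hS : PosCondition S) :
    PosCondition (JetRestriction.restrictModel '' S) := by
  rintro r p A P ⟨⟨r', p', A'⟩, hJ, hJ'⟩ hP
  simp only [JetRestriction.restrictModel, Prod.mk.injEq] at hJ'
  obtain ⟨rfl, rfl, rfl⟩ := hJ'
  exact ⟨(r', p', A' + P.pull (ContinuousLinearMap.fst ℝ V W)),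
    hS _ _ _ _ hJ fun v => hP _, rfl⟩

end Forms

/-! ### Calculus of 2-jets on normed spaces. -/

section Derivatives

variable {V W : Type*} [NormedAddCommGroup V] [NormedSpace ℝ V]
  [NormedAddCommGroup W] [NormedSpace ℝ W]

/-- The 2-jet of `f` at `x` (the symmetrisation is harmless if `f` is `C²` near `x`). -/
def jetAt (f : V → ℝ) (x : V) : JetModel V :=
  (f x, fderiv ℝ f x, symmetrize (fderiv ℝ (fderiv ℝ f) x))

theorem ContDiffAt.symm_fderiv_fderiv {f : V → ℝ} {x : V} (hf : ContDiffAt ℝ 2 f x) (v w : V) :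
    fderiv ℝ (fderiv ℝ f) x v w = fderiv ℝ (fderiv ℝ f) x w v :=
  (hf.isSymmSndFDerivAt (by simp)).eq v w

theorem jetAt_eq_iff_derivs {f : V → ℝ} {x : V} (hf : ContDiffAt ℝ 2 f x) {J : JetModel V} :
    jetAt f x = J ↔ derivs f x = (J.1, J.2.1, J.2.2.form) := by
  obtain ⟨r, p, A⟩ := J
  simp only [jetAt, derivs, Prod.mk.injEq]
  refine and_congr_right fun _ => and_congr_right fun _ => ⟨fun h => ?_, fun h => ?_⟩
  · rw [← h, form_symmetrize (ContDiffAt.symm_fderiv_fderiv hf)]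
  · rw [h, symmetrize_form]

theorem jetAt_congr {f g : V → ℝ} {x : V} (h : f =ᶠ[𝓝 x] g) : jetAt f x = jetAt g x := by
  simp only [jetAt, h.eq_of_nhds, h.fderiv_eq, h.fderiv.fderiv_eq]

theorem derivs_comp_eq {f : W → ℝ} {τ : V → W} {x : V}
    (hf : ContDiffAt ℝ 2 f (τ x)) (hτ : ContDiffAt ℝ 2 τ x) :
    derivs (f ∘ τ) x = (f (τ x), (fderiv ℝ f (τ x)).comp (fderiv ℝ τ x),
      (ContinuousLinearMap.compL ℝ V W ℝ (fderiv ℝ f (τ x))).comp (fderiv ℝ (fderiv ℝ τ) x) +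
        (fderiv ℝ (fderiv ℝ f) (τ x)).bilinearComp (fderiv ℝ τ x) (fderiv ℝ τ x)) := by
  have h1 : fderiv ℝ (f ∘ τ) =ᶠ[𝓝 x] fun y => (fderiv ℝ f (τ y)).comp (fderiv ℝ τ y) := by
    have hf1 : ∀ᶠ z in 𝓝 (τ x), ContDiffAt ℝ 2 f z := hf.eventually (by simp)
    filter_upwards [hτ.eventually (by simp), hτ.continuousAt.eventually hf1] with y hy hy'
    exact fderiv_comp y (hy'.differentiableAt (by simp)) (hy.differentiableAt (by simp))
  have hdf : DifferentiableAt ℝ (fderiv ℝ f) (τ x) :=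
    (hf.fderiv_right (m := 1) (by norm_num)).differentiableAt (by simp)
  have hdτ : DifferentiableAt ℝ (fderiv ℝ τ) x :=
    (hτ.fderiv_right (m := 1) (by norm_num)).differentiableAt (by simp)
  have hc : HasFDerivAt (fun y => fderiv ℝ f (τ y))
      ((fderiv ℝ (fderiv ℝ f) (τ x)).comp (fderiv ℝ τ x)) x :=
    hdf.hasFDerivAt.comp x (hτ.differentiableAt (by simp)).hasFDerivAt
  simp only [derivs, Prod.mk.injEq]
  refine ⟨rfl, h1.self_of_nhds, ?_⟩
  rw [h1.fderiv_eq, (hc.clm_comp hdτ.hasFDerivAt).fderiv]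
  rfl

theorem derivs_quadPoly_apply (x : V) (J : JetModel V) (v : V) :
    derivs (quadPoly x J) v = (quadPoly x J v, J.2.1 + J.2.2.form (v - x), J.2.2.form) := by
  have h1 : ∀ y, HasFDerivAt (quadPoly x J) (J.2.1 + J.2.2.form (y - x)) y := by
    intro y
    have hid : HasFDerivAt (fun v : V => v - x) (ContinuousLinearMap.id ℝ V) y :=
      (hasFDerivAt_id y).sub_const x
    have ha : HasFDerivAt (fun v => J.2.1 (v - x)) (J.2.1.comp (ContinuousLinearMap.id ℝ V)) y :=
      J.2.1.hasFDerivAt.comp y hid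
    have hb : HasFDerivAt (fun v => J.2.2.form (v - x))
        (J.2.2.form.comp (ContinuousLinearMap.id ℝ V)) y := J.2.2.form.hasFDerivAt.comp y hid
    have hc := ((ha.const_add J.1).add ((hb.clm_apply hid).const_mul (1 / 2 : ℝ)))
    refine (hc.congr_fderiv ?_)
    ext v
    change J.2.1 v + (1 / 2 : ℝ) * (J.2.2.form (y - x) v + J.2.2.form v (y - x)) =
      J.2.1 v + J.2.2.form (y - x) v
    rw [J.2.2.form_symm v (y - x)]
    ring
  have h2 : fderiv ℝ (quadPoly x J) = fun y => J.2.1 + J.2.2.form (y - x) :=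
    funext fun y => (h1 y).fderiv
  have h3 : HasFDerivAt (fun y => J.2.1 + J.2.2.form (y - x)) J.2.2.form v :=
    (J.2.2.form.hasFDerivAt.comp v ((hasFDerivAt_id v).sub_const x)).const_add _
  simp only [derivs, Prod.mk.injEq]
  exact ⟨trivial, by rw [h2], by rw [h2]; exact h3.fderiv⟩

theorem derivs_quadPoly (x : V) (J : JetModel V) :
    derivs (quadPoly x J) x = (J.1, J.2.1, J.2.2.form) := by
  rw [derivs_quadPoly_apply]
  simp [quadPoly]

theorem quadPoly_contDiffAt (x : V) (J : JetModel V) (y : V) :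
    ContDiffAt ℝ 2 (quadPoly x J) y :=
  ((quadPoly_contDiff x J).contDiffAt).of_le two_le_infty

theorem jetAt_quadPoly (x : V) (J : JetModel V) : jetAt (quadPoly x J) x = J :=
  (jetAt_eq_iff_derivs (quadPoly_contDiffAt x J x)).2 (derivs_quadPoly x J)

theorem jetAt_quadPoly_apply (x : V) (J : JetModel V) (v : V) :
    jetAt (quadPoly x J) v = (quadPoly x J v, J.2.1 + J.2.2.form (v - x), J.2.2) :=
  (jetAt_eq_iff_derivs (quadPoly_contDiffAt x J v)).2 (derivs_quadPoly_apply x J v)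

theorem jetAt_add {f g : V → ℝ} {x : V} (hf : ContDiffAt ℝ 2 f x) (hg : ContDiffAt ℝ 2 g x) :
    jetAt (f + g) x = jetAt f x + jetAt g x := by
  have h1 : fderiv ℝ (f + g) =ᶠ[𝓝 x] fderiv ℝ f + fderiv ℝ g := by
    filter_upwards [hf.eventually (by simp), hg.eventually (by simp)] with y hy hy'
    exact fderiv_add (hy.differentiableAt (by simp)) (hy'.differentiableAt (by simp))
  have hdf : DifferentiableAt ℝ (fderiv ℝ f) x :=
    (hf.fderiv_right (m := 1) (by norm_num)).differentiableAt (by simp)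
  have hdg : DifferentiableAt ℝ (fderiv ℝ g) x :=
    (hg.fderiv_right (m := 1) (by norm_num)).differentiableAt (by simp)
  simp only [jetAt, Prod.mk_add_mk, Prod.mk.injEq]
  refine ⟨rfl, h1.self_of_nhds, ?_⟩
  rw [h1.fderiv_eq, fderiv_add hdf hdg, map_add]

theorem continuousAt_jetAt {f : V → ℝ} {x : V} (hf : ContDiffAt ℝ 2 f x) :
    ContinuousAt (jetAt f) x := by
  have h1 : ContDiffAt ℝ 1 (fderiv ℝ f) x := hf.fderiv_right (by norm_num)
  have h2 : ContDiffAt ℝ 0 (fderiv ℝ (fderiv ℝ f)) x := h1.fderiv_right (by norm_num)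
  have h3 : ContinuousAt (fun y => symmetrize (fderiv ℝ (fderiv ℝ f) y)) x :=
    (symmetrize (V := V)).continuous.continuousAt.comp h2.continuousAt
  exact hf.continuousAt.prodMk (h1.continuousAt.prodMk h3)

/-- The jet of `f ∘ τ` when `f` has jet `J`, `τ` has derivative `L` and second derivative `Q`. -/
def pullModel (L : V →L[ℝ] W) (Q : V →L[ℝ] V →L[ℝ] W) (J : JetModel W) : JetModel V :=
  (J.1, J.2.1.comp L, symmetrize ((ContinuousLinearMap.compL ℝ V W ℝ J.2.1).comp Q) +
    J.2.2.pull L)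

theorem jetAt_comp {f : W → ℝ} {τ : V → W} {x : V}
    (hf : ContDiffAt ℝ 2 f (τ x)) (hτ : ContDiffAt ℝ 2 τ x) :
    jetAt (f ∘ τ) x = pullModel (fderiv ℝ τ x) (fderiv ℝ (fderiv ℝ τ) x) (jetAt f (τ x)) := by
  have h := derivs_comp_eq hf hτ
  simp only [derivs, Prod.mk.injEq] at h
  simp only [jetAt, pullModel, Prod.mk.injEq]
  refine ⟨h.1, h.2.1, ?_⟩
  rw [h.2.2, map_add]
  rfl

theorem SymForm.continuous_pull {α : Type*} [TopologicalSpace α] {ℓ : α → V →L[ℝ] W}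
    {A : α → SymForm W} (hℓ : Continuous ℓ) (hA : Continuous A) :
    Continuous fun a => (A a).pull (ℓ a) := by
  refine continuous_induced_rng.2 ?_
  have hf : Continuous fun a => SymForm.form (A a) := SymForm.form.continuous.comp hA
  have hc : Continuous fun a => (ContinuousLinearMap.compL ℝ V W ℝ).flip (ℓ a) :=
    (ContinuousLinearMap.compL ℝ V W ℝ).flip.continuous.comp hℓ
  exact hc.clm_comp (hf.clm_comp hℓ)

theorem continuous_pullModel : Continuous
    fun q : (V →L[ℝ] W) × (V →L[ℝ] V →L[ℝ] W) × JetModel W => pullModel q.1 q.2.1 q.2.2 := by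
  have hJ : Continuous fun q : (V →L[ℝ] W) × (V →L[ℝ] V →L[ℝ] W) × JetModel W => q.2.2 :=
    continuous_snd.comp continuous_snd
  have hp : Continuous fun q : (V →L[ℝ] W) × (V →L[ℝ] V →L[ℝ] W) × JetModel W => q.2.2.2.1 :=
    continuous_fst.comp (continuous_snd.comp hJ)
  have hA : Continuous fun q : (V →L[ℝ] W) × (V →L[ℝ] V →L[ℝ] W) × JetModel W => q.2.2.2.2 :=
    continuous_snd.comp (continuous_snd.comp hJ)
  have hc : Continuous fun q : (V →L[ℝ] W) × (V →L[ℝ] V →L[ℝ] W) × JetModel W =>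
      ContinuousLinearMap.compL ℝ V W ℝ q.2.2.2.1 :=
    (ContinuousLinearMap.compL ℝ V W ℝ).continuous.comp hp
  have hQ : Continuous fun q : (V →L[ℝ] W) × (V →L[ℝ] V →L[ℝ] W) × JetModel W => q.2.1 :=
    continuous_fst.comp continuous_snd
  have hB : Continuous fun q : (V →L[ℝ] W) × (V →L[ℝ] V →L[ℝ] W) × JetModel W =>
      (ContinuousLinearMap.compL ℝ V W ℝ q.2.2.2.1).comp q.2.1 := hc.clm_comp hQ
  have hsym : Continuous fun q : (V →L[ℝ] W) × (V →L[ℝ] V →L[ℝ] W) × JetModel W =>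
      symmetrize ((ContinuousLinearMap.compL ℝ V W ℝ q.2.2.2.1).comp q.2.1) :=
    (symmetrize (V := V)).continuous.comp hB
  have hpull : Continuous fun q : (V →L[ℝ] W) × (V →L[ℝ] V →L[ℝ] W) × JetModel W =>
      q.2.2.2.2.pull q.1 := SymForm.continuous_pull continuous_fst hA
  exact (continuous_fst.comp hJ).prodMk
    ((hp.clm_comp continuous_fst).prodMk (hsym.add hpull))

/-- The correction by the second derivative `Q` involves only `p`, so an increment of the
second-order part transforms as a pure quadratic form. This makes (P) independent of coordinates. -/
theorem pullModel_add (L : V →L[ℝ] W) (Q : V →L[ℝ] V →L[ℝ] W) (r : ℝ) (p : W →L[ℝ] ℝ)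
    (A P : SymForm W) : ∃ r' p' A', pullModel L Q (r, p, A) = (r', p', A') ∧
      pullModel L Q (r, p, A + P) = (r', p', A' + P.pull L) :=
  ⟨_, _, _, rfl, by
    simp only [pullModel, ← SymForm.pullL_apply, map_add, add_assoc]⟩

/-- The slice inclusion is affine, so the chain rule has no second-derivative correction and reduces
to `i*`. -/
theorem restrictModel_jetAt {f : V × W → ℝ} {x : V} {y : W} (hf : ContDiffAt ℝ 2 f (x, y)) :
    restrictModel (jetAt f (x, y)) = jetAt (fun v => f (v, y)) x := by
  have hτ' : fderiv ℝ (fun v : V => (v, y)) = fun _ => ContinuousLinearMap.inl ℝ V W :=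
    funext fun v => (hasFDerivAt_prodMk_left v y).fderiv
  have h := jetAt_comp (τ := fun v : V => (v, y)) (x := x) hf (by fun_prop)
  refine Eq.trans ?_ h.symm
  rw [hτ']
  simp [pullModel, restrictModel]

end Derivatives

/-! ### Jets on a manifold in local coordinates; subequations from local jet equivalence. -/

section Coordinates

variable {E : Type*} [NormedAddCommGroup E] [NormedSpace ℝ E]
  {M : Type*} [TopologicalSpace M] [ChartedSpace E M]
  {V V' : Type*} [NormedAddCommGroup V] [NormedSpace ℝ V]
  [NormedAddCommGroup V'] [NormedSpace ℝ V']

theorem jet_eq_jet_iff {f g : M → ℝ} {z : M} (hf : ContMDiffAt 𝓘(ℝ, E) 𝓘(ℝ, ℝ) 2 f z)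
    (hg : ContMDiffAt 𝓘(ℝ, E) 𝓘(ℝ, ℝ) 2 g z) :
    jet E f z hf = jet E g z hg ↔ derivs (f ∘ (chartAt E z).symm) (chartAt E z z) =
      derivs (g ∘ (chartAt E z).symm) (chartAt E z z) := by
  refine Iff.trans ⟨fun h => eq_of_heq (Sigma.mk.inj_iff.1 h).2, fun h => ?_⟩
    (Quotient.eq (r := jetSetoid E z) (x := ⟨f, hf⟩) (y := ⟨g, hg⟩))
  exact congrArg (Sigma.mk z) h

theorem jet_congr_point {f : M → ℝ} {z z' : M} (h : z = z')
    (hf : ContMDiffAt 𝓘(ℝ, E) 𝓘(ℝ, ℝ) 2 f z) :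
    jet E f z hf = jet E f z' (h ▸ hf) := by
  subst h
  rfl

theorem LocalCoord.contMDiffAt (e : LocalCoord E M V) {z : M} (hz : z ∈ e.toHomeo.source) :
    ContMDiffAt 𝓘(ℝ, E) 𝓘(ℝ, V) ∞ e.toHomeo z :=
  e.smooth.contMDiffAt (e.toHomeo.open_source.mem_nhds hz)

theorem LocalCoord.contMDiffAt_symm (e : LocalCoord E M V) {x : V} (hx : x ∈ e.toHomeo.target) :
    ContMDiffAt 𝓘(ℝ, V) 𝓘(ℝ, E) ∞ e.toHomeo.symm x :=
  e.smooth_symm.contMDiffAt (e.toHomeo.open_target.mem_nhds hx)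

theorem LocalCoord.contDiffAt_comp_symm (e : LocalCoord E M V) {f : M → ℝ} {x : V}
    (hx : x ∈ e.toHomeo.target)
    (hf : ContMDiffAt 𝓘(ℝ, E) 𝓘(ℝ, ℝ) 2 f (e.toHomeo.symm x)) :
    ContDiffAt ℝ 2 (f ∘ e.toHomeo.symm) x :=
  (hf.comp x ((e.contMDiffAt_symm hx).of_le two_le_infty)).contDiffAt

theorem LocalCoord.contMDiffAt_comp (e : LocalCoord E M V) {g : V → ℝ} {z : M}
    (hz : z ∈ e.toHomeo.source) (hg : ContDiffAt ℝ 2 g (e.toHomeo z)) :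
    ContMDiffAt 𝓘(ℝ, E) 𝓘(ℝ, ℝ) 2 (g ∘ e.toHomeo) z :=
  hg.contMDiffAt.comp z ((e.contMDiffAt hz).of_le two_le_infty)

theorem LocalCoord.contDiffAt_transition (e : LocalCoord E M V) (e' : LocalCoord E M V') {x : V'}
    (hx : x ∈ e'.toHomeo.target) (hx' : e'.toHomeo.symm x ∈ e.toHomeo.source) :
    ContDiffAt ℝ ∞ (e.toHomeo ∘ e'.toHomeo.symm) x :=
  ((e.contMDiffAt hx').comp x (e'.contMDiffAt_symm hx)).contDiffAt

theorem LocalCoord.comp_symm_eventuallyEq (e : LocalCoord E M V) (e' : LocalCoord E M V')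
    (f : M → ℝ) {x : V'} (hx : x ∈ e'.toHomeo.target)
    (hx' : e'.toHomeo.symm x ∈ e.toHomeo.source) :
    f ∘ e'.toHomeo.symm =ᶠ[𝓝 x]
      (f ∘ e.toHomeo.symm) ∘ (e.toHomeo ∘ e'.toHomeo.symm) := by
  filter_upwards [(e'.toHomeo.continuousAt_symm hx).eventually
    (e.toHomeo.open_source.mem_nhds hx')] with y hy
  simp [e.toHomeo.left_inv hy]

theorem LocalCoord.derivs_eq_of_derivs_eq (e : LocalCoord E M V) (e' : LocalCoord E M V')
    {f g : M → ℝ} {z : M} (hz : z ∈ e.toHomeo.source) (hz' : z ∈ e'.toHomeo.source)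
    (hf : ContMDiffAt 𝓘(ℝ, E) 𝓘(ℝ, ℝ) 2 f z) (hg : ContMDiffAt 𝓘(ℝ, E) 𝓘(ℝ, ℝ) 2 g z)
    (h : derivs (f ∘ e.toHomeo.symm) (e.toHomeo z) = derivs (g ∘ e.toHomeo.symm) (e.toHomeo z)) :
    derivs (f ∘ e'.toHomeo.symm) (e'.toHomeo z) =
      derivs (g ∘ e'.toHomeo.symm) (e'.toHomeo z) := by
  have hx := e'.toHomeo.map_source hz'
  have hinv := e'.toHomeo.left_inv hz'
  have hx' : e'.toHomeo.symm (e'.toHomeo z) ∈ e.toHomeo.source := by rwa [hinv]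
  have hτ : (e.toHomeo ∘ e'.toHomeo.symm) (e'.toHomeo z) = e.toHomeo z := by simp [hinv]
  rw [derivs_congr (e.comp_symm_eventuallyEq e' f hx hx'),
    derivs_congr (e.comp_symm_eventuallyEq e' g hx hx')]
  have hC : ∀ {k : M → ℝ}, ContMDiffAt 𝓘(ℝ, E) 𝓘(ℝ, ℝ) 2 k z →
      ContDiffAt ℝ 2 (k ∘ e.toHomeo.symm) (e.toHomeo z) := fun hk =>
    e.contDiffAt_comp_symm (e.toHomeo.map_source hz) (by rwa [e.toHomeo.left_inv hz])
  refine derivs_comp ?_ ?_ ((e.contDiffAt_transition e' hx hx').of_le two_le_infty) ?_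
  · rw [hτ]; exact hC hf
  · rw [hτ]; exact hC hg
  · rw [hτ]; exact h

/-- The preferred chart at `z` as a local coordinate system. -/
def chartCoord [IsManifold 𝓘(ℝ, E) ∞ M] (z : M) : LocalCoord E M E where
  toHomeo := chartAt E z
  smooth := contMDiffOn_chart
  smooth_symm := contMDiffOn_chart_symm

variable [IsManifold 𝓘(ℝ, E) ∞ M]

theorem LocalCoord.jet_eq_jet_iff (e : LocalCoord E M V) {f g : M → ℝ} {z : M}
    (hz : z ∈ e.toHomeo.source)
    (hf : ContMDiffAt 𝓘(ℝ, E) 𝓘(ℝ, ℝ) 2 f z) (hg : ContMDiffAt 𝓘(ℝ, E) 𝓘(ℝ, ℝ) 2 g z) :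
    jet E f z hf = jet E g z hg ↔ derivs (f ∘ e.toHomeo.symm) (e.toHomeo z) =
      derivs (g ∘ e.toHomeo.symm) (e.toHomeo z) := by
  rw [JetRestriction.jet_eq_jet_iff hf hg]
  exact ⟨(chartCoord z).derivs_eq_of_derivs_eq e (mem_chart_source E z) hz hf hg,
    e.derivs_eq_of_derivs_eq (chartCoord z) hz (mem_chart_source E z) hf hg⟩

theorem LocalCoord.jet_eq_jetOf_iff (e : LocalCoord E M V) (x : e.toHomeo.target) {f : M → ℝ}
    (hf : ContMDiffAt 𝓘(ℝ, E) 𝓘(ℝ, ℝ) 2 f (e.toHomeo.symm x)) {J : JetModel V} :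
    jet E f (e.toHomeo.symm x) hf = e.jetOf x J ↔ jetAt (f ∘ e.toHomeo.symm) x = J := by
  unfold LocalCoord.jetOf
  rw [e.jet_eq_jet_iff (e.toHomeo.map_target x.2), e.toHomeo.right_inv x.2]
  have hq : (quadPoly (x : V) J ∘ e.toHomeo) ∘ e.toHomeo.symm =ᶠ[𝓝 (x : V)] quadPoly (x : V) J := by
    filter_upwards [e.toHomeo.open_target.mem_nhds x.2] with y hy
    simp [e.toHomeo.right_inv hy]
  rw [derivs_congr hq, derivs_quadPoly, jetAt_eq_iff_derivs (e.contDiffAt_comp_symm x.2 hf)]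

theorem LocalCoord.jet_mem_iff (e : LocalCoord E M V) (x : e.toHomeo.target) {f : M → ℝ}
    (hf : ContMDiffAt 𝓘(ℝ, E) 𝓘(ℝ, ℝ) 2 f (e.toHomeo.symm x)) {F : Set (JetBundle E M)} :
    jet E f (e.toHomeo.symm x) hf ∈ F ↔ jetAt (f ∘ e.toHomeo.symm) x ∈ fibre F e x := by
  rw [(e.jet_eq_jetOf_iff x hf).2 rfl]
  rfl

/-- The transition law of the jet bundle: apply the second-order chain rule to the quadratic
polynomial representing `J` and the coordinate change. -/
theorem LocalCoord.jetOf_eq_jetOf (e : LocalCoord E M V) (e' : LocalCoord E M V')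
    (x : e.toHomeo.target) (x' : e'.toHomeo.target)
    (h : e.toHomeo.symm x = e'.toHomeo.symm x') (J : JetModel V) :
    e.jetOf x J = e'.jetOf x' (pullModel (fderiv ℝ (e.toHomeo ∘ e'.toHomeo.symm) x')
      (fderiv ℝ (fderiv ℝ (e.toHomeo ∘ e'.toHomeo.symm)) x') J) := by
  have hs : e'.toHomeo.symm x' ∈ e.toHomeo.source := h ▸ e.toHomeo.map_target x.2
  have hτ : (e.toHomeo ∘ e'.toHomeo.symm) x' = x := by
    simp [← h, e.toHomeo.right_inv x.2]
  conv_lhs => rw [LocalCoord.jetOf, jet_congr_point h]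
  rw [e'.jet_eq_jetOf_iff x']
  change jetAt (quadPoly (x : V) J ∘ (e.toHomeo ∘ e'.toHomeo.symm)) x' = _
  rw [jetAt_comp (quadPoly_contDiffAt _ _ _)
    ((e.contDiffAt_transition e' x'.2 hs).of_le two_le_infty), hτ, jetAt_quadPoly]

/-- In any coordinates, membership in `F` near a point reads `G q ∈ S`, where `G` is the coordinate
change followed by the automorphism. Continuity of `G` gives closedness. On second-order increments
`G` acts by pull-backs of forms, which preserve nonnegativity, so (P) transfers as well. -/
theorem LocallyJetEquivalent.isSubequation {F : Set (JetBundle E M)} {S : Set (JetModel V)}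
    (h : LocallyJetEquivalent F S) (hS : IsConstSubequation S) : IsSubequation F := by
  refine ⟨?_, ?_⟩
  · unfold JetBundle.instTopologicalSpace
    -- In a final topology, a set is closed exactly when its preimage under every trivialization is
    -- closed.
    rw [isClosed_iSup_iff]
    intro e
    rw [isClosed_coinduced, ← isOpen_compl_iff, isOpen_iff_mem_nhds]
    intro q₀ hq₀
    obtain ⟨e', hz, Φ, ⟨hΦ, -⟩, hFΦ⟩ := h (e.toHomeo.symm q₀.1)
    have hsymm : ContinuousAt (fun q : e.toHomeo.target × JetModel E => e.toHomeo.symm q.1) q₀ :=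
      ContinuousAt.comp (f := fun q : e.toHomeo.target × JetModel E => (q.1 : E))
        (e.toHomeo.continuousAt_symm q₀.1.2) (by fun_prop)
    have hx' : ContinuousAt
        (fun q : e.toHomeo.target × JetModel E => e'.toHomeo (e.toHomeo.symm q.1)) q₀ :=
      ContinuousAt.comp (e'.toHomeo.continuousAt hz) hsymm
    have ht := e'.toHomeo.map_source hz
    set x₀ := e'.toHomeo (e.toHomeo.symm q₀.1) with hx₀
    have hinv : e'.toHomeo.symm x₀ = e.toHomeo.symm q₀.1 := e'.toHomeo.left_inv hz
    have hτ : ContDiffAt ℝ ∞ (e.toHomeo ∘ e'.toHomeo.symm) x₀ :=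
      e.contDiffAt_transition e' ht (hinv ▸ e.toHomeo.map_target q₀.1.2)
    have hτ1 : ContDiffAt ℝ ∞ (fderiv ℝ (e.toHomeo ∘ e'.toHomeo.symm)) x₀ :=
      hτ.fderiv_right (by simp)
    have hτ2 : ContDiffAt ℝ ∞ (fderiv ℝ (fderiv ℝ (e.toHomeo ∘ e'.toHomeo.symm))) x₀ :=
      hτ1.fderiv_right (by simp)
    let T : e.toHomeo.target × JetModel E → JetModel V := fun q =>
      pullModel (fderiv ℝ (e.toHomeo ∘ e'.toHomeo.symm) (e'.toHomeo (e.toHomeo.symm q.1)))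
        (fderiv ℝ (fderiv ℝ (e.toHomeo ∘ e'.toHomeo.symm)) (e'.toHomeo (e.toHomeo.symm q.1))) q.2
    have hT : ContinuousAt T q₀ :=
      continuous_pullModel.continuousAt.comp
        ((hτ1.continuousAt.comp_of_eq hx' hx₀.symm).prodMk
          ((hτ2.continuousAt.comp_of_eq hx' hx₀.symm).prodMk continuousAt_snd))
    have hΦc : ContinuousAt (fun q : e.toHomeo.target × JetModel E =>
        (Φ (e'.toHomeo (e.toHomeo.symm q.1)) : RedJet V →L[ℝ] RedJet V)) q₀ :=
      ContinuousAt.comp_of_eq (g := fun x => (Φ x : RedJet V →L[ℝ] RedJet V))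
        ((hΦ.contDiffAt (e'.toHomeo.open_target.mem_nhds ht)).continuousAt) hx' hx₀.symm
    have hG : ContinuousAt (fun q : e.toHomeo.target × JetModel E =>
        actJet (Φ (e'.toHomeo (e.toHomeo.symm q.1))) (T q)) q₀ :=
      hT.fst.prodMk (hΦc.clm_apply hT.snd)
    have key : ∀ q : e.toHomeo.target × JetModel E, e.toHomeo.symm q.1 ∈ e'.toHomeo.source →
        (e.jetOf q.1 q.2 ∈ F ↔ actJet (Φ (e'.toHomeo (e.toHomeo.symm q.1))) (T q) ∈ S) := by
      intro q hq
      rw [e.jetOf_eq_jetOf e' q.1 ⟨_, e'.toHomeo.map_source hq⟩ (e'.toHomeo.left_inv hq).symm]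
      exact hFΦ ⟨_, e'.toHomeo.map_source hq⟩ _
    have hq₀' := mt (key q₀ hz).2 hq₀
    filter_upwards [hG.eventually (hS.1.isOpen_compl.mem_nhds hq₀'),
      hsymm.eventually (e'.toHomeo.open_source.mem_nhds hz)] with q h1 h2
    exact mt (key q h2).1 h1
  · intro e x r p A P hA hP
    obtain ⟨e', hz, Φ, ⟨-, k, -, hk⟩, hFΦ⟩ := h (e.toHomeo.symm x)
    have ht := e'.toHomeo.map_source hz
    have hinv := (e'.toHomeo.left_inv hz).symm
    obtain ⟨L, Q, key⟩ : ∃ (L : V →L[ℝ] E) (Q : V →L[ℝ] V →L[ℝ] E), ∀ J : JetModel E,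
        J ∈ fibre F e x ↔
          actJet (Φ (e'.toHomeo (e.toHomeo.symm x))) (pullModel L Q J) ∈ S := by
      refine ⟨fderiv ℝ (e.toHomeo ∘ e'.toHomeo.symm) (e'.toHomeo (e.toHomeo.symm x)),
        fderiv ℝ (fderiv ℝ (e.toHomeo ∘ e'.toHomeo.symm)) (e'.toHomeo (e.toHomeo.symm x)),
        fun J => ?_⟩
      change e.jetOf x J ∈ F ↔ _
      rw [e.jetOf_eq_jetOf e' x ⟨_, ht⟩ hinv]
      exact hFΦ ⟨_, ht⟩ _
    rw [key] at hA ⊢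
    obtain ⟨r', p', A', h1, h2⟩ := pullModel_add L Q r p A P
    rw [h1] at hA
    rw [h2]
    -- Isolate the increment as an element of `Sym²`, the subbundle on which the automorphism is
    -- known to act by pull-back along `k`.
    have hadd : ((p', A' + P.pull L) : RedJet V) = (p', A') + (0, P.pull L) := by simp
    simp only [actJet] at hA ⊢
    rw [hadd, map_add, hk _ ht]
    have := hS.2 _ _ _
      (SymForm.pull (k (e'.toHomeo (e.toHomeo.symm x)) : V →L[ℝ] V) (P.pull L)) hA fun v => hP _
    convert this using 2
    ext1 <;> simp

end Coordinates

/-! ### Adapted coordinates and the restricted set of jets. -/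

section Slice

variable {E₁ E₂ : Type*} [NormedAddCommGroup E₁] [NormedSpace ℝ E₁]
  [NormedAddCommGroup E₂] [NormedSpace ℝ E₂]
  {X Z : Type*} [TopologicalSpace Z] [ChartedSpace E₂ Z]
  {V W : Type*} [NormedAddCommGroup V] [NormedSpace ℝ V]
  [NormedAddCommGroup W] [NormedSpace ℝ W]
  {i : X → Z} {e : LocalCoord E₂ Z (V × W)} {y₀ : W}

/-- The point of `X` with coordinates `(v, y₀)`. -/
def slicePoint (x₀ : X) (i : X → Z) (e : LocalCoord E₂ Z (V × W)) (y₀ : W) (v : V) : X :=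
  haveI : Nonempty X := ⟨x₀⟩
  Function.invFun i (e.toHomeo.symm (v, y₀))

theorem IsAdapted.map_slicePoint (he : IsAdapted i e y₀) (x₀ : X) {v : V}
    (hv : (v, y₀) ∈ e.toHomeo.target) : i (slicePoint x₀ i e y₀ v) = e.toHomeo.symm (v, y₀) := by
  have : Nonempty X := ⟨x₀⟩
  refine Function.invFun_eq ((he _ (e.toHomeo.map_target hv)).2 ?_)
  rw [e.toHomeo.right_inv hv]

theorem IsAdapted.eq_mk (he : IsAdapted i e y₀) {x : X} (hx : i x ∈ e.toHomeo.source) :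
    e.toHomeo (i x) = ((e.toHomeo (i x)).1, y₀) :=
  Prod.ext rfl ((he _ hx).1 ⟨x, rfl⟩)

variable [TopologicalSpace X] [ChartedSpace E₁ X]

theorem IsAdapted.continuousOn_slicePoint (he : IsAdapted i e y₀) (hi : Topology.IsEmbedding i)
    (x₀ : X) : ContinuousOn (slicePoint x₀ i e y₀) {v | (v, y₀) ∈ e.toHomeo.target} := by
  rw [hi.isInducing.continuousOn_iff]
  have h : ContinuousOn (fun v : V => e.toHomeo.symm (v, y₀)) {v | (v, y₀) ∈ e.toHomeo.target} :=
    e.toHomeo.continuousOn_symm.comp (by fun_prop) fun v hv => hv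
  exact h.congr fun v hv => he.map_slicePoint x₀ hv

/-- Adapted coordinates `(x, y)` on `Z` restrict to coordinates `x` on the slice `X`. -/
def IsAdapted.sliceCoord (he : IsAdapted i e y₀)
    (hi : Manifold.IsSmoothEmbedding 𝓘(ℝ, E₁) 𝓘(ℝ, E₂) ∞ i)
    [IsManifold 𝓘(ℝ, E₁) ∞ X] [IsManifold 𝓘(ℝ, E₂) ∞ Z] (x₀ : X) : LocalCoord E₁ X V where
  toHomeo :=
    { toFun := fun x => (e.toHomeo (i x)).1
      invFun := slicePoint x₀ i e y₀
      source := i ⁻¹' e.toHomeo.source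
      target := {v | (v, y₀) ∈ e.toHomeo.target}
      map_source' := fun x hx => by
        have := e.toHomeo.map_source hx
        rwa [he.eq_mk hx] at this
      map_target' := fun v hv => by
        rw [Set.mem_preimage, he.map_slicePoint x₀ hv]
        exact e.toHomeo.map_target hv
      left_inv' := fun x hx => by
        have hx' : ((e.toHomeo (i x)).1, y₀) ∈ e.toHomeo.target := by
          rw [← he.eq_mk hx]
          exact e.toHomeo.map_source hx
        apply hi.isEmbedding.injective
        rw [he.map_slicePoint x₀ hx', ← he.eq_mk hx, e.toHomeo.left_inv hx]
      right_inv' := fun v hv => by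
        rw [he.map_slicePoint x₀ hv, e.toHomeo.right_inv hv]
      open_source := e.toHomeo.open_source.preimage hi.contMDiff.continuous
      open_target := e.toHomeo.open_target.preimage (by fun_prop)
      continuousOn_toFun := continuous_fst.comp_continuousOn
        (e.toHomeo.continuousOn.comp hi.contMDiff.continuous.continuousOn fun x hx => hx)
      continuousOn_invFun := he.continuousOn_slicePoint hi.isEmbedding x₀ }
  smooth := by
    have h1 : ContMDiffOn 𝓘(ℝ, E₁) 𝓘(ℝ, V × W) ∞ (e.toHomeo ∘ i) (i ⁻¹' e.toHomeo.source) :=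
      e.smooth.comp hi.contMDiff.contMDiffOn fun x hx => hx
    exact (contDiff_fst.contMDiff (n := ∞)).comp_contMDiffOn h1
  smooth_symm := by
    intro v hv
    have ho : IsOpen {v : V | (v, y₀) ∈ e.toHomeo.target} :=
      e.toHomeo.open_target.preimage (by fun_prop)
    refine ContMDiffAt.contMDiffWithinAt ?_
    -- A continuous map into `X` is smooth once its composite with the immersion `i` is. Continuity
    -- comes from the embedding, and the composite is `e.toHomeo.symm` along the slice.
    refine (ContMDiffAt.iff_comp_isImmersionAt (hi.isImmersion.isImmersionAt _)).2 ⟨?_, ?_⟩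
    · exact (he.continuousOn_slicePoint hi.isEmbedding x₀).continuousAt (ho.mem_nhds hv)
    · have h1 : ContMDiffAt 𝓘(ℝ, V) 𝓘(ℝ, V × W) ∞ (fun v : V => (v, y₀)) v :=
        (contDiff_prodMk_left y₀).contMDiff.contMDiffAt
      refine ((e.contMDiffAt_symm hv).comp v h1).congr_of_eventuallyEq ?_
      filter_upwards [ho.mem_nhds hv] with w hw
      exact he.map_slicePoint x₀ hw

variable [IsManifold 𝓘(ℝ, E₁) ∞ X] [IsManifold 𝓘(ℝ, E₂) ∞ Z]

theorem mem_restrictSet_jet_iff (hi : ContMDiff 𝓘(ℝ, E₁) 𝓘(ℝ, E₂) ∞ i)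
    {F : Set (JetBundle E₂ Z)} {g : X → ℝ} {x : X} (hg : ContMDiffAt 𝓘(ℝ, E₁) 𝓘(ℝ, ℝ) 2 g x) :
    jet E₁ g x hg ∈ restrictSet i hi F ↔
      ∃ (f : Z → ℝ) (hf : ContMDiffAt 𝓘(ℝ, E₂) 𝓘(ℝ, ℝ) 2 f (i x)), jet E₂ f (i x) hf ∈ F ∧
        jet E₁ (f ∘ i) x (hf.comp x ((hi x).of_le two_le_infty)) = jet E₁ g x hg := by
  constructor
  · rintro ⟨j, hj, hj'⟩
    induction j using Quotient.inductionOn with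
    | h f => exact ⟨f.1, f.2, hj, congrArg (Sigma.mk x) hj'⟩
  · rintro ⟨f, hf, hfF, h⟩
    exact ⟨Quotient.mk (jetSetoid E₂ (i x)) ⟨f, hf⟩, hfF, eq_of_heq (Sigma.mk.inj_iff.1 h).2⟩

/-- In slice coordinates `f ∘ i` is `v ↦ f(v, y₀)`, so the geometric restriction of jets agrees with
`i*`. For the inclusion `⊇`, each model jet is realised by its quadratic polynomial. -/
theorem IsAdapted.fibre_restrictSet (he : IsAdapted i e y₀)
    (hi : Manifold.IsSmoothEmbedding 𝓘(ℝ, E₁) 𝓘(ℝ, E₂) ∞ i) (x₀ : X)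
    (F : Set (JetBundle E₂ Z)) (x : (he.sliceCoord hi x₀).toHomeo.target) :
    fibre (restrictSet i hi.contMDiff F) (he.sliceCoord hi x₀) x =
      restrictModel '' fibre F e ⟨((x : V), y₀), x.2⟩ := by
  let c := he.sliceCoord hi x₀
  have hpt : ∀ v : V, (v, y₀) ∈ e.toHomeo.target → i (c.toHomeo.symm v) = e.toHomeo.symm (v, y₀) :=
    fun v hv => he.map_slicePoint x₀ hv
  have hev : ∀ f : Z → ℝ, (f ∘ i) ∘ c.toHomeo.symm =ᶠ[𝓝 (x : V)]
      fun v => (f ∘ e.toHomeo.symm) (v, y₀) := fun f => by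
    filter_upwards [c.toHomeo.open_target.mem_nhds x.2] with v hv
    exact congrArg f (hpt v hv)
  have hres : ∀ f : Z → ℝ, ContMDiffAt 𝓘(ℝ, E₂) 𝓘(ℝ, ℝ) 2 f (e.toHomeo.symm ((x : V), y₀)) →
      jetAt ((f ∘ i) ∘ c.toHomeo.symm) x =
        restrictModel (jetAt (f ∘ e.toHomeo.symm) ((x : V), y₀)) := fun f hf => by
    rw [jetAt_congr (hev f), restrictModel_jetAt (e.contDiffAt_comp_symm x.2 hf)]
  ext J
  change c.jetOf x J ∈ restrictSet i hi.contMDiff F ↔ _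
  conv_lhs => rw [LocalCoord.jetOf, mem_restrictSet_jet_iff]
  constructor
  · rintro ⟨f, hf, hfF, h⟩
    rw [jet_congr_point (hpt x x.2)] at hfF
    refine ⟨_, (e.jet_mem_iff ⟨((x : V), y₀), x.2⟩ _).1 hfF, ?_⟩
    rw [← hres f (by rwa [← hpt x x.2])]
    exact (c.jet_eq_jetOf_iff x _).1 h
  · rintro ⟨K, hK, rfl⟩
    have hf := e.contMDiffAt_quadPoly ⟨((x : V), y₀), x.2⟩ K
    have hf' : ContMDiffAt 𝓘(ℝ, E₂) 𝓘(ℝ, ℝ) 2 (quadPoly ((x : V), y₀) K ∘ e.toHomeo)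
      (i (c.toHomeo.symm x)) := by rw [hpt x x.2]; exact hf
    refine ⟨_, hf', ?_, ?_⟩
    · rw [jet_congr_point (hpt x x.2)]
      exact hK
    · refine (c.jet_eq_jetOf_iff x _).2 ?_
      rw [hres _ hf]
      exact congrArg restrictModel ((e.jet_eq_jetOf_iff ⟨((x : V), y₀), x.2⟩ hf).1 rfl)

/-- From `i* ∘ Φ = φ ∘ i*` one gets `φ(i* F) = i*(Φ F) = i* S`; the reverse implication uses
surjectivity of `Φ` and injectivity of `φ`. -/
theorem IsAdapted.mem_fibre_restrictSet_iff (he : IsAdapted i e y₀)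
    (hi : Manifold.IsSmoothEmbedding 𝓘(ℝ, E₁) 𝓘(ℝ, E₂) ∞ i) (x₀ : X)
    {F : Set (JetBundle E₂ Z)} {S : Set (JetModel (V × W))}
    {Φ : V × W → RedJet (V × W) ≃L[ℝ] RedJet (V × W)} {φ : V → RedJet V ≃L[ℝ] RedJet V}
    (hΦφ : ∀ x, (x, y₀) ∈ e.toHomeo.target → ∀ J : JetModel (V × W),
      restrictModel (actJet (Φ (x, y₀)) J) = actJet (φ x) (restrictModel J))
    (hF : ∀ (z : e.toHomeo.target) (J : JetModel (V × W)), J ∈ fibre F e z ↔ actJet (Φ z) J ∈ S)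
    (x : (he.sliceCoord hi x₀).toHomeo.target) (J : JetModel V) :
    J ∈ fibre (restrictSet i hi.contMDiff F) (he.sliceCoord hi x₀) x ↔
      actJet (φ x) J ∈ restrictModel '' S := by
  rw [he.fibre_restrictSet hi x₀]
  constructor
  · rintro ⟨K, hK, rfl⟩
    exact ⟨_, (hF _ K).1 hK, hΦφ _ x.2 K⟩
  · rintro ⟨L, hL, hLJ⟩
    have hinv : actJet (Φ ((x : V), y₀)) (actJet (Φ ((x : V), y₀)).symm L) = L := by
      simp [actJet]
    refine ⟨actJet (Φ ((x : V), y₀)).symm L, (hF ⟨((x : V), y₀), x.2⟩ _).2 ?_, ?_⟩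
    · rwa [hinv]
    · have h := hΦφ x x.2 (actJet (Φ ((x : V), y₀)).symm L)
      rw [hinv, hLJ] at h
      simp only [actJet, Prod.mk.injEq] at h
      exact Prod.ext h.1.symm ((φ x).injective h.2.symm)

theorem locallyJetEquivalent_restrictSet
    (hi : Manifold.IsSmoothEmbedding 𝓘(ℝ, E₁) 𝓘(ℝ, E₂) ∞ i)
    {F : Set (JetBundle E₂ Z)} {S : Set (JetModel (V × W))}
    (hFS : LocallyJetEquivalentModulo i F S) :
    LocallyJetEquivalent (restrictSet i hi.contMDiff F) (restrictModel '' S) := by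
  intro x₀
  obtain ⟨e, y₀, hx₀, he, Φ, ⟨-, φ, hφ, hΦφ⟩, hF⟩ := hFS x₀
  exact ⟨he.sliceCoord hi x₀, hx₀, φ, hφ, he.mem_fibre_restrictSet_iff hi x₀ hΦφ hF⟩

end Slice

/-! ### Maxima of upper semicontinuous functions minus a penalty. -/

section Penalization

open Filter

variable {V W : Type*} [NormedAddCommGroup V] [NormedSpace ℝ V] [FiniteDimensional ℝ V]
  [NormedAddCommGroup W] [NormedSpace ℝ W] [FiniteDimensional ℝ W]

/-- Take `a` to be a maximum point of `u - P` on `K`. The value `0` at `z₀` makes the maximum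
nonnegative, which excludes `u a = -∞` and gives `P a ≤ r`. The last clause says that `P`, shifted
by `r - P a`, touches `u` from above at `a`. -/
theorem exists_isMaxOn_sub_penalty {α : Type*} [TopologicalSpace α] {K : Set α} (hK : IsCompact K)
    {u : α → EReal} (hu : UpperSemicontinuousOn u K) (hu' : ∀ z ∈ K, u z < ⊤) {P : α → ℝ}
    (hP : ContinuousOn P K) {z₀ : α} (hz₀ : z₀ ∈ K) (h₀ : u z₀ = P z₀) :
    ∃ a ∈ K, ∃ r : ℝ, u a = r ∧ P a ≤ r ∧ ∀ w ∈ K, u w ≤ ((r - P a + P w : ℝ) : EReal) := by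
  have hsc : UpperSemicontinuousOn (fun w => u w + ((-P w : ℝ) : EReal)) K := by
    refine hu.add' ?_ fun x _ => EReal.continuousAt_add (by simp) (by simp)
    exact (continuous_coe_real_ereal.comp_continuousOn hP.neg).upperSemicontinuousOn
  obtain ⟨a, haK, ha⟩ := hsc.exists_isMaxOn ⟨z₀, hz₀⟩ hK
  have h0 : ((0 : ℝ) : EReal) ≤ u a + ((-P a : ℝ) : EReal) := by
    have h := ha hz₀
    simp only [Set.mem_ofPred_eq, h₀] at h
    rwa [← EReal.coe_add, add_neg_cancel] at h
  have htop := (hu' a haK).ne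
  have hbot : u a ≠ ⊥ := by
    intro hb
    rw [hb, EReal.bot_add] at h0
    exact absurd h0 (by simp)
  obtain ⟨r, hr⟩ : ∃ r : ℝ, u a = r := ⟨(u a).toReal, (EReal.coe_toReal htop hbot).symm⟩
  refine ⟨a, haK, r, hr, ?_, fun w hw => ?_⟩
  · rw [hr, ← EReal.coe_add, EReal.coe_le_coe_iff] at h0
    linarith
  · have h : u w + ((-P w : ℝ) : EReal) ≤ u a + ((-P a : ℝ) : EReal) := ha hw
    rw [hr] at h
    rcases eq_or_ne (u w) ⊥ with hb | hb
    · rw [hb]; exact bot_le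
    obtain ⟨s, hs⟩ : ∃ s : ℝ, u w = s :=
      ⟨(u w).toReal, (EReal.coe_toReal (hu' w hw).ne hb).symm⟩
    rw [hs] at h ⊢
    rw [← EReal.coe_add, ← EReal.coe_add, EReal.coe_le_coe_iff] at h
    rw [EReal.coe_le_coe_iff]
    linarith

/-- If `u (·, y₀) - g` has a strict local maximum `0` at `x₀`, then `u - g - N ‖y - y₀‖²` has local
maxima converging to `(x₀, y₀)` along a sequence of `N`, with `N ‖y - y₀‖² → 0` there. -/
theorem exists_seq_penalized_max {D : Set (V × W)} (hD : IsOpen D) {u : V × W → EReal}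
    (hu : UpperSemicontinuousOn u D) (hu' : ∀ z ∈ D, u z < ⊤) {x₀ : V} {y₀ : W}
    (hz₀ : (x₀, y₀) ∈ D) {g : V → ℝ} (hg : ∀ᶠ x in 𝓝 x₀, ContinuousAt g x)
    (hlt : ∀ᶠ x in 𝓝 x₀, x ≠ x₀ → u (x, y₀) < g x) (h₀ : u (x₀, y₀) = g x₀) :
    ∃ (z : ℕ → V × W) (N r : ℕ → ℝ), Tendsto z atTop (𝓝 (x₀, y₀)) ∧
      Tendsto r atTop (𝓝 (g x₀)) ∧ (∀ k, 0 ≤ N k) ∧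
      Tendsto (fun k => N k * ‖(z k).2 - y₀‖ ^ 2) atTop (𝓝 0) ∧
      ∀ᶠ k in atTop, z k ∈ D ∧ u (z k) = r k ∧ ∀ᶠ w in 𝓝 (z k),
        u w ≤ ((r k - (g (z k).1 + N k * ‖(z k).2 - y₀‖ ^ 2) +
          (g w.1 + N k * ‖w.2 - y₀‖ ^ 2) : ℝ) : EReal) := by
  obtain ⟨ρ₁, hρ₁, hball⟩ := Metric.eventually_nhds_iff_ball.1 (hg.and hlt)
  obtain ⟨ρ₂, hρ₂, hD₂⟩ := Metric.isOpen_iff.1 hD _ hz₀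
  set ρ := min ρ₁ ρ₂ / 2 with hρdef
  have hρ : 0 < ρ := by positivity
  have hρlt : ρ < min ρ₁ ρ₂ := half_lt_self (by positivity)
  set K := Metric.closedBall ((x₀, y₀) : V × W) ρ with hKdef
  have hK : IsCompact K := isCompact_closedBall _ _
  have hKD : K ⊆ D := fun z hz => hD₂ (lt_of_le_of_lt hz (hρlt.trans_le (min_le_right _ _)))
  have hKx : ∀ z ∈ K, z.1 ∈ Metric.ball x₀ ρ₁ := fun z hz =>
    lt_of_le_of_lt ((le_max_left _ _).trans hz) (hρlt.trans_le (min_le_left _ _))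
  have hz₀K : (x₀, y₀) ∈ K := Metric.mem_closedBall_self hρ.le
  have hgK : ContinuousOn (fun z : V × W => g z.1) K := fun z hz =>
    (ContinuousAt.comp (f := Prod.fst) (hball z.1 (hKx z hz)).1 continuousAt_fst).continuousWithinAt
  have huK : UpperSemicontinuousOn u K := hu.mono hKD
  have huK' : ∀ z ∈ K, u z < ⊤ := fun z hz => hu' z (hKD hz)
  have hmax : ∀ N : ℕ, ∃ a ∈ K, ∃ r : ℝ, u a = r ∧ g a.1 + N * ‖a.2 - y₀‖ ^ 2 ≤ r ∧
      ∀ w ∈ K, u w ≤ ((r - (g a.1 + N * ‖a.2 - y₀‖ ^ 2) +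
        (g w.1 + N * ‖w.2 - y₀‖ ^ 2) : ℝ) : EReal) := fun N =>
    exists_isMaxOn_sub_penalty hK huK huK' (P := fun w => g w.1 + N * ‖w.2 - y₀‖ ^ 2)
      (hgK.add (by fun_prop)) hz₀K (by simp [h₀])
  choose a haK r hr hPr hmaxr using hmax
  obtain ⟨C, hC⟩ : ∃ C : ℝ, ∀ N, r N ≤ C := by
    obtain ⟨b, hbK, hb⟩ := huK.exists_isMaxOn ⟨_, hz₀K⟩ hK
    obtain ⟨C, hC, -⟩ := EReal.lt_iff_exists_real_btwn.1 (huK' b hbK)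
    refine ⟨C, fun N => ?_⟩
    have h : u (a N) ≤ u b := hb (haK N)
    rw [hr] at h
    exact EReal.coe_le_coe_iff.1 (h.trans hC.le)
  obtain ⟨m, hm⟩ : ∃ m : ℝ, ∀ z ∈ K, m ≤ g z.1 := by
    obtain ⟨m, hm⟩ := hK.bddBelow_image hgK
    exact ⟨m, fun z hz => hm ⟨z, hz, rfl⟩⟩
  obtain ⟨z', hz'K, σ, hσ, hlim⟩ := hK.tendsto_subseq haK
  have hlim1 : Tendsto (fun k => (a (σ k)).1) atTop (𝓝 z'.1) :=
    (continuous_fst.tendsto z').comp hlim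
  have hlim2 : Tendsto (fun k => (a (σ k)).2) atTop (𝓝 z'.2) :=
    (continuous_snd.tendsto z').comp hlim
  have hglim : Tendsto (fun k => g (a (σ k)).1) atTop (𝓝 (g z'.1)) :=
    (hball z'.1 (hKx z' hz'K)).1.tendsto.comp hlim1
  -- Since `g + N‖y - y₀‖² ≤ r`, with `r ≤ C` and `g ≥ m` on `K`, the maximum points satisfy `‖y -
  -- y₀‖² ≤ (C - m) / N`.
  have hy : z'.2 = y₀ := by
    have h1 : Tendsto (fun k => ‖(a (σ k)).2 - y₀‖ ^ 2) atTop (𝓝 (‖z'.2 - y₀‖ ^ 2)) :=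
      ((hlim2.sub_const y₀).norm).pow 2
    have h2 : Tendsto (fun k => (C - m) / (σ k : ℝ)) atTop (𝓝 0) :=
      (tendsto_const_div_atTop_nhds_zero_nat (C - m)).comp hσ.tendsto_atTop
    have h3 : ‖z'.2 - y₀‖ ^ 2 ≤ 0 := by
      refine le_of_tendsto_of_tendsto h1 h2 ?_
      filter_upwards [hσ.tendsto_atTop.eventually (eventually_gt_atTop 0)] with k hk
      have hk' : (0 : ℝ) < σ k := by exact_mod_cast hk
      rw [le_div_iff₀ hk']
      linarith [hPr (σ k), hC (σ k), hm _ (haK (σ k))]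
    have h4 : ‖z'.2 - y₀‖ = 0 := by
      have := sq_nonneg ‖z'.2 - y₀‖
      exact pow_eq_zero_iff (two_ne_zero) |>.1 (le_antisymm h3 this)
    exact sub_eq_zero.1 (norm_eq_zero.1 h4)
  have husc : ∀ c : ℝ, u z' < c → ∀ᶠ k in atTop, r (σ k) < c := fun c hc => by
    have h1 := hu z' (hKD hz'K) c hc
    rw [hD.nhdsWithin_eq (hKD hz'K)] at h1
    filter_upwards [hlim.eventually h1] with k hk
    simp only [Function.comp_apply, hr] at hk
    exact EReal.coe_lt_coe_iff.1 hk
  have hNnn : ∀ k, 0 ≤ (σ k : ℝ) * ‖(a (σ k)).2 - y₀‖ ^ 2 := fun k => by positivity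
  -- Otherwise strictness gives a real `c` with `u z' < c < g z'.1`. Upper semicontinuity forces
  -- eventually `r < c`, while `g ≤ r` forces `g z'.1 ≤ c` in the limit.
  have hx : z'.1 = x₀ := by
    by_contra hne
    have h1 : u z' < g z'.1 := by
      have := (hball z'.1 (hKx z' hz'K)).2 hne
      rwa [← hy] at this
    obtain ⟨c, hc1, hc2⟩ := EReal.lt_iff_exists_real_btwn.1 h1
    have h2 : g z'.1 ≤ c := by
      refine le_of_tendsto hglim ?_
      filter_upwards [husc c hc1] with k hk
      linarith [hPr (σ k), hNnn k]
    exact absurd (EReal.coe_lt_coe_iff.1 hc2) (not_lt.2 h2)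
  have hz' : z' = (x₀, y₀) := Prod.ext hx hy
  subst hz'
  simp only at hglim husc
  have hrlim : Tendsto (fun k => r (σ k)) atTop (𝓝 (g x₀)) := by
    refine tendsto_order.2 ⟨fun c hc => ?_, fun c hc => ?_⟩
    · filter_upwards [hglim.eventually (lt_mem_nhds hc)] with k hk
      linarith [hPr (σ k), hNnn k]
    · exact husc c (by rw [h₀]; exact EReal.coe_lt_coe_iff.2 hc)
  refine ⟨a ∘ σ, fun k => σ k, r ∘ σ, hlim, hrlim, fun k => Nat.cast_nonneg _, ?_, ?_⟩
  -- The penalty at the maximum point is at most `r - g`, and both terms tend to `g x₀`.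
  · have h1 : Tendsto (fun k => r (σ k) - g (a (σ k)).1) atTop (𝓝 0) := by
      simpa using hrlim.sub hglim
    refine squeeze_zero hNnn (fun k => ?_) h1
    have := hPr (σ k)
    simp only [Function.comp_apply]
    linarith
  · filter_upwards [hlim.eventually (Metric.ball_mem_nhds _ hρ)] with k hk
    refine ⟨hKD (haK _), hr _, ?_⟩
    filter_upwards [Metric.isOpen_ball.mem_nhds hk] with w hw
    exact hmaxr (σ k) w (Metric.ball_subset_closedBall hw)

end Penalization

/-! ### The restriction theorem in coordinates. -/

section LocalRestriction

open Filter

theorem jetAt_comp_clm {U U' : Type*} [NormedAddCommGroup U] [NormedSpace ℝ U]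
    [NormedAddCommGroup U'] [NormedSpace ℝ U'] (ℓ : U →L[ℝ] U') {f : U' → ℝ} {x : U}
    (hf : ContDiffAt ℝ 2 f (ℓ x)) :
    jetAt (f ∘ ℓ) x = ((jetAt f (ℓ x)).1, (jetAt f (ℓ x)).2.1.comp ℓ,
      (jetAt f (ℓ x)).2.2.pull ℓ) := by
  have h : fderiv ℝ ℓ = fun _ => ℓ := funext fun y => ℓ.fderiv
  rw [jetAt_comp hf ℓ.contDiff.contDiffAt, h]
  simp [pullModel]

theorem tendsto_clm_apply {α G G' : Type*} [NormedAddCommGroup G] [NormedSpace ℝ G]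
    [NormedAddCommGroup G'] [NormedSpace ℝ G'] {l : Filter α} {R : α → G →L[ℝ] G'}
    {R₀ : G →L[ℝ] G'} {v : α → G} {v₀ : G} (hR : Tendsto R l (𝓝 R₀)) (hv : Tendsto v l (𝓝 v₀)) :
    Tendsto (fun a => R a (v a)) l (𝓝 (R₀ v₀)) :=
  (isBoundedBilinearMap_apply.continuous.tendsto (R₀, v₀)).comp (hR.prodMk_nhds hv)

/-- The inner product as a symmetric form. -/
def innerForm (W : Type*) [NormedAddCommGroup W] [InnerProductSpace ℝ W] : SymForm W :=
  (⟨LinearMap.mkContinuous₂ (innerₗ W) 1 fun v w => by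
      simpa using abs_real_inner_le_norm v w,
    fun v w => real_inner_comm w v⟩ : ↥(symSubmodule W))

theorem innerForm_apply {W : Type*} [NormedAddCommGroup W] [InnerProductSpace ℝ W] (v w : W) :
    (innerForm W).form v w = inner ℝ v w := rfl

variable {V W : Type*} [NormedAddCommGroup V] [InnerProductSpace ℝ V]
  [NormedAddCommGroup W] [InnerProductSpace ℝ W]

theorem quadPoly_innerForm (c N : ℝ) (y₀ y : W) :
    quadPoly y₀ (c, 0, (2 * N) • innerForm W) y = c + N * ‖y - y₀‖ ^ 2 := by
  have h : ((2 * N) • innerForm W).form (y - y₀) (y - y₀) = 2 * N * ‖y - y₀‖ ^ 2 := by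
    rw [← real_inner_self_eq_norm_sq]
    rfl
  simp only [quadPoly, h, zero_apply]
  ring

theorem contDiff_norm_sub_sq (x₀ : V) : ContDiff ℝ ∞ fun x : V => ‖x - x₀‖ ^ 2 :=
  (contDiff_id.sub contDiff_const).norm_sq ℝ

/-- Both `t ↦ t²` at `0` and `‖x - x₀‖²` at `x₀` have vanishing derivative, so every term of the
chain rule is zero. This allows contact to be made strict without changing the jet. -/
theorem jetAt_quartic (x₀ : V) : jetAt (fun x : V => (‖x - x₀‖ ^ 2) ^ 2) x₀ = 0 := by
  have hs : (fun x : V => ‖x - x₀‖ ^ 2) = quadPoly x₀ (0, 0, (2 * (1 : ℝ)) • innerForm V) := by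
    ext x
    rw [quadPoly_innerForm]
    ring
  have hd : fderiv ℝ (fun x : V => ‖x - x₀‖ ^ 2) x₀ = 0 := by
    have h := jetAt_quadPoly x₀ (0, 0, (2 * (1 : ℝ)) • innerForm V)
    rw [← hs] at h
    exact congrArg (fun J : JetModel V => J.2.1) h
  have h := jetAt_comp (f := fun t : ℝ => t ^ 2) (τ := fun x : V => ‖x - x₀‖ ^ 2) (x := x₀)
    (by fun_prop) ((contDiff_norm_sub_sq x₀).contDiffAt.of_le two_le_infty)
  refine h.trans ?_
  rw [hd]
  have hp : fderiv ℝ (fun t : ℝ => t ^ 2) 0 = 0 := by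
    ext
    simp
  have hpull : ∀ A : SymForm ℝ, A.pull (0 : V →L[ℝ] ℝ) = 0 := fun A => by
    refine SymForm.ext_form ?_
    ext v w
    rw [SymForm.pull_form]
    simp
  simp [pullModel, jetAt, hp, hpull]

/-- The jet of `(x, y) ↦ g x + c + N ‖y - y₀‖²`. -/
theorem jetAt_penalized {g : V → ℝ} (c N : ℝ) (y₀ : W) {z : V × W} (hg : ContDiffAt ℝ 2 g z.1) :
    jetAt (fun w : V × W => g w.1 + (c + N * ‖w.2 - y₀‖ ^ 2)) z =
      (g z.1 + (c + N * ‖z.2 - y₀‖ ^ 2),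
        ((fderiv ℝ g z.1).comp (ContinuousLinearMap.fst ℝ V W),
          (jetAt g z.1).2.2.pull (ContinuousLinearMap.fst ℝ V W)) +
        (2 * N) • (((innerForm W).form (z.2 - y₀)).comp (ContinuousLinearMap.snd ℝ V W),
          (innerForm W).pull (ContinuousLinearMap.snd ℝ V W))) := by
  have h1 : (fun w : V × W => g w.1 + (c + N * ‖w.2 - y₀‖ ^ 2)) =
      g ∘ (ContinuousLinearMap.fst ℝ V W) +
        quadPoly y₀ (c, 0, (2 * N) • innerForm W) ∘ (ContinuousLinearMap.snd ℝ V W) := by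
    ext w
    simp only [Pi.add_apply, Function.comp_apply, quadPoly_innerForm]
    rfl
  have hg' : ContDiffAt ℝ 2 g (ContinuousLinearMap.fst ℝ V W z) := hg
  have hq := quadPoly_contDiffAt y₀ (c, 0, (2 * N) • innerForm W) (ContinuousLinearMap.snd ℝ V W z)
  have hfst := (ContinuousLinearMap.fst ℝ V W).contDiff.contDiffAt (x := z) (n := 2)
  have hsnd := (ContinuousLinearMap.snd ℝ V W).contDiff.contDiffAt (x := z) (n := 2)
  rw [h1, jetAt_add (hg'.comp z hfst) (hq.comp z hsnd), jetAt_comp_clm _ hg', jetAt_comp_clm _ hq,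
    jetAt_quadPoly_apply, quadPoly_innerForm]
  simp only [zero_add]
  rfl

/-- A `C¹` map is locally Lipschitz; compare each point with its projection to the slice. It is used
for maps that vanish on the slice, fully or on given vectors. -/
theorem exists_norm_sub_slice_le {G : Type*} [NormedAddCommGroup G] {f : V × W → G}
    [NormedSpace ℝ G] {x₀ : V} {y₀ : W} (hf : ContDiffAt ℝ ∞ f (x₀, y₀)) :
    ∃ L : ℝ, 0 ≤ L ∧ ∀ᶠ z in 𝓝 (x₀, y₀), ‖f z - f (z.1, y₀)‖ ≤ L * ‖z.2 - y₀‖ := by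
  obtain ⟨L, t, ht, hL⟩ := (hf.of_le (by simp : (1 : WithTop ℕ∞) ≤ ∞)).exists_lipschitzOnWith
  have hc : Tendsto (fun z : V × W => (z.1, y₀)) (𝓝 (x₀, y₀)) (𝓝 (x₀, y₀)) :=
    Continuous.tendsto' (by fun_prop) _ _ rfl
  refine ⟨L, L.2, ?_⟩
  filter_upwards [ht, hc ht] with z hz hz'
  have h := hL.dist_le_mul z hz _ hz'
  rw [dist_eq_norm] at h
  refine h.trans (le_of_eq ?_)
  rw [Prod.dist_eq, dist_self, dist_eq_norm, max_eq_right (norm_nonneg _)]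

set_option maxHeartbeats 800000 in
-- The penalty coefficient `N` may be unbounded; only `N‖y - y₀‖² → 0` is available. So each penalty
-- term must be shown to be of second order in `‖y - y₀‖` after applying `i* ∘ Φ`.
theorem tendsto_restrictRed {D : Set (V × W)} (hD : IsOpen D)
    {Φ : V × W → RedJet (V × W) ≃L[ℝ] RedJet (V × W)} (hΦ : IsJetAutomorphism D Φ) {y₀ : W}
    {φ : V → RedJet V ≃L[ℝ] RedJet V}
    (hΦφ : ∀ x, (x, y₀) ∈ D → ∀ j, restrictRed (Φ (x, y₀) j) = φ x (restrictRed j))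
    {x₀ : V} (hz₀ : (x₀, y₀) ∈ D) {z : ℕ → V × W} (hz : Tendsto z atTop (𝓝 (x₀, y₀)))
    {N : ℕ → ℝ} (hN : ∀ k, 0 ≤ N k)
    (hNz : Tendsto (fun k => N k * ‖(z k).2 - y₀‖ ^ 2) atTop (𝓝 0))
    {j : ℕ → RedJet V} {j₀ : RedJet V} (hj : Tendsto j atTop (𝓝 j₀)) :
    Tendsto (fun k => restrictRed (Φ (z k)
      (((j k).1.comp (ContinuousLinearMap.fst ℝ V W),
          (j k).2.pull (ContinuousLinearMap.fst ℝ V W)) +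
        (2 * N k) • (((innerForm W).form ((z k).2 - y₀)).comp (ContinuousLinearMap.snd ℝ V W),
          (innerForm W).pull (ContinuousLinearMap.snd ℝ V W))))) atTop (𝓝 (φ x₀ j₀)) := by
  obtain ⟨hΦs, κ, hκs, hκ⟩ := hΦ
  have hDz : D ∈ 𝓝 (x₀, y₀) := hD.mem_nhds hz₀
  have hslice : ∀ᶠ z : V × W in 𝓝 (x₀, y₀), (z.1, y₀) ∈ D := by
    have hc : Tendsto (fun z : V × W => (z.1, y₀)) (𝓝 (x₀, y₀)) (𝓝 (x₀, y₀)) :=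
      Continuous.tendsto' (by fun_prop) _ _ rfl
    exact hc hDz
  let R : V × W → RedJet (V × W) →L[ℝ] RedJet V := fun z =>
    restrictRed.comp (Φ z : RedJet (V × W) →L[ℝ] RedJet (V × W))
  have hR : ContDiffAt ℝ ∞ R (x₀, y₀) := contDiffAt_const.clm_comp (hΦs.contDiffAt hDz)
  -- The block of `hᵗ` from slice to normal directions; the restricted image of `|dy|²` is the form
  -- `v ↦ ‖T z v‖²`.
  let T : V × W → V →L[ℝ] W := fun z => (ContinuousLinearMap.snd ℝ V W).comp
    ((κ z : V × W →L[ℝ] V × W).comp (ContinuousLinearMap.inl ℝ V W))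
  have hT : ContDiffAt ℝ ∞ T (x₀, y₀) :=
    contDiffAt_const.clm_comp ((hκs.contDiffAt hDz).clm_comp contDiffAt_const)
  have hRB : ∀ z ∈ D, R z (0, (innerForm W).pull (ContinuousLinearMap.snd ℝ V W)) =
      (0, (innerForm W).pull (T z)) := fun z hz => by
    change restrictRed (Φ z _) = _
    rw [hκ z hz]
    rfl
  -- On the slice, `i*` kills `|dy|²`, hence so does `i* ∘ Φ = φ ∘ i*`. Definiteness of the inner
  -- product then gives `T = 0`.
  have hT0 : ∀ x, (x, y₀) ∈ D → T (x, y₀) = 0 := fun x hx => by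
    have h1 := hΦφ x hx (0, (innerForm W).pull (ContinuousLinearMap.snd ℝ V W))
    have h2 : restrictRed (0, (innerForm W).pull (ContinuousLinearMap.snd ℝ V W)) =
        (0 : RedJet V) := by
      rw [restrictRed_apply]
      refine Prod.ext (by simp) (SymForm.ext_form ?_)
      ext v w
      rw [SymForm.pull_form, SymForm.pull_form, innerForm_apply]
      simp
    rw [h2, map_zero] at h1
    have h3 : (0, (innerForm W).pull (T (x, y₀))) = (0 : RedJet V) := (hRB _ hx).symm.trans h1
    have h4 : (innerForm W).pull (T (x, y₀)) = 0 := congrArg Prod.snd h3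
    ext1 v
    have h5 : (innerForm W).form (T (x, y₀) v) (T (x, y₀) v) = 0 := by
      rw [← SymForm.pull_form, h4]
      simp
    rw [innerForm_apply] at h5
    simpa using h5
  obtain ⟨L, hL0, hL⟩ := exists_norm_sub_slice_le hR
  obtain ⟨L', hL'0, hL'⟩ := exists_norm_sub_slice_le hT
  have h1 : Tendsto (fun k => R (z k) ((j k).1.comp (ContinuousLinearMap.fst ℝ V W),
      (j k).2.pull (ContinuousLinearMap.fst ℝ V W))) atTop (𝓝 (φ x₀ j₀)) := by
    let I : RedJet V →L[ℝ] RedJet (V × W) :=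
      ((ContinuousLinearMap.compL ℝ (V × W) V ℝ).flip (ContinuousLinearMap.fst ℝ V W)).prodMap
        (SymForm.pullL (ContinuousLinearMap.fst ℝ V W))
    have hI : Tendsto (fun k => I (j k)) atTop (𝓝 (I j₀)) := (I.continuous.tendsto j₀).comp hj
    have hlim : Tendsto (fun k => R (z k) (I (j k))) atTop (𝓝 (R (x₀, y₀) (I j₀))) :=
      tendsto_clm_apply (hR.continuousAt.tendsto.comp hz) hI
    have hval : R (x₀, y₀) (I j₀) = φ x₀ j₀ := by
      change restrictRed (Φ (x₀, y₀) (I j₀)) = _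
      rw [hΦφ x₀ hz₀]
      rfl
    rw [hval] at hlim
    exact hlim
  -- First-order penalty: the covector has norm at most `‖y - y₀‖`, and `R` kills it on the slice,
  -- which gives a second factor `L‖y - y₀‖`.
  have h2 : Tendsto (fun k => R (z k) ((2 * N k) •
      (((innerForm W).form ((z k).2 - y₀)).comp (ContinuousLinearMap.snd ℝ V W), 0)))
      atTop (𝓝 0) := by
    have hb : Tendsto (fun k => 2 * L * (N k * ‖(z k).2 - y₀‖ ^ 2)) atTop (𝓝 0) := by
      simpa using hNz.const_mul (2 * L)
    refine squeeze_zero_norm' ?_ hb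
    filter_upwards [hz.eventually hL, hz.eventually hslice] with k hk hk'
    set q : V × W →L[ℝ] ℝ :=
      ((innerForm W).form ((z k).2 - y₀)).comp (ContinuousLinearMap.snd ℝ V W) with hq
    have hqn : ‖((q, 0) : RedJet (V × W))‖ ≤ ‖(z k).2 - y₀‖ := by
      rw [Prod.norm_mk, norm_zero, max_eq_left (norm_nonneg _)]
      refine ContinuousLinearMap.opNorm_le_bound _ (norm_nonneg _) fun w => ?_
      refine (norm_inner_le_norm ((z k).2 - y₀) w.2).trans ?_
      gcongr
      exact norm_snd_le w
    have hR0 : R ((z k).1, y₀) (q, 0) = 0 := by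
      change restrictRed (Φ ((z k).1, y₀) (q, 0)) = 0
      have h0 : restrictRed ((q, 0) : RedJet (V × W)) = 0 := by
        rw [restrictRed_apply]
        refine Prod.ext ?_ (SymForm.ext_form ?_)
        · ext v
          simp [hq]
        · ext v w
          rw [SymForm.pull_form]
          simp
      rw [hΦφ _ hk', h0, map_zero]
    rw [map_smul, norm_smul, Real.norm_of_nonneg (by linarith [hN k])]
    have h3 : ‖R (z k) (q, 0)‖ ≤ L * ‖(z k).2 - y₀‖ * ‖(z k).2 - y₀‖ := by
      have h4 : R (z k) (q, 0) = (R (z k) - R ((z k).1, y₀)) (q, 0) := by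
        rw [sub_apply, hR0, sub_zero]
      rw [h4]
      exact (ContinuousLinearMap.le_opNorm _ _).trans (by gcongr)
    calc 2 * N k * ‖R (z k) (q, 0)‖
        ≤ 2 * N k * (L * ‖(z k).2 - y₀‖ * ‖(z k).2 - y₀‖) :=
          mul_le_mul_of_nonneg_left h3 (by linarith [hN k])
      _ = 2 * L * (N k * ‖(z k).2 - y₀‖ ^ 2) := by ring
  -- Second-order penalty: `‖T z‖ ≤ L'‖y - y₀‖` enters squared, because pull-back is quadratic in
  -- the map.
  have h3 : Tendsto (fun k => R (z k) ((2 * N k) •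
      (0, (innerForm W).pull (ContinuousLinearMap.snd ℝ V W)))) atTop (𝓝 0) := by
    have hb : Tendsto (fun k => 2 * L' ^ 2 * ‖innerForm W‖ * (N k * ‖(z k).2 - y₀‖ ^ 2))
        atTop (𝓝 0) := by
      simpa using hNz.const_mul (2 * L' ^ 2 * ‖innerForm W‖)
    refine squeeze_zero_norm' ?_ hb
    filter_upwards [hz.eventually hL', hz.eventually hslice, hz.eventually hDz] with k hk hk' hkD
    rw [hT0 _ hk', sub_zero] at hk
    rw [map_smul, norm_smul, Real.norm_of_nonneg (by linarith [hN k]), hRB _ hkD, Prod.norm_mk,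
      norm_zero, max_eq_right (norm_nonneg _)]
    have h4 : ‖(innerForm W).pull (T (z k))‖ ≤ (L' * ‖(z k).2 - y₀‖) ^ 2 * ‖innerForm W‖ :=
      (SymForm.norm_pull_le _ _).trans (by gcongr)
    calc 2 * N k * ‖(innerForm W).pull (T (z k))‖
        ≤ 2 * N k * ((L' * ‖(z k).2 - y₀‖) ^ 2 * ‖innerForm W‖) :=
          mul_le_mul_of_nonneg_left h4 (by linarith [hN k])
      _ = 2 * L' ^ 2 * ‖innerForm W‖ * (N k * ‖(z k).2 - y₀‖ ^ 2) := by ring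
  have h4 := h1.add (h2.add h3)
  rw [add_zero, add_zero] at h4
  refine h4.congr fun k => ?_
  have hsum : ∀ (q : V × W →L[ℝ] ℝ) (B : SymForm (V × W)),
      ((q, 0) : RedJet (V × W)) + (0, B) = (q, B) := fun q B => by simp
  rw [← map_add, ← map_add, ← smul_add, hsum]
  rfl

variable [FiniteDimensional ℝ V] [FiniteDimensional ℝ W]

/-- The restriction theorem in coordinates. -/
theorem actJet_jetAt_mem_restrictModel {D : Set (V × W)} (hD : IsOpen D) {u : V × W → EReal}
    (hu : UpperSemicontinuousOn u D) (hu' : ∀ z ∈ D, u z < ⊤)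
    {S : Set (JetModel (V × W))} (hS : IsClosed (restrictModel '' S))
    {Φ : V × W → RedJet (V × W) ≃L[ℝ] RedJet (V × W)} (hΦ : IsJetAutomorphism D Φ) {y₀ : W}
    {φ : V → RedJet V ≃L[ℝ] RedJet V}
    (hΦφ : ∀ x, (x, y₀) ∈ D → ∀ J : JetModel (V × W),
      restrictModel (actJet (Φ (x, y₀)) J) = actJet (φ x) (restrictModel J))
    (hsub : ∀ z ∈ D, ∀ ψ : V × W → ℝ, ContDiffAt ℝ 2 ψ z → (∀ᶠ w in 𝓝 z, u w ≤ (ψ w : EReal)) →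
      u z = (ψ z : EReal) → actJet (Φ z) (jetAt ψ z) ∈ S)
    {x₀ : V} (hz₀ : (x₀, y₀) ∈ D) {f : V → ℝ} (hf : ContDiffAt ℝ 2 f x₀)
    (hle : ∀ᶠ x in 𝓝 x₀, u (x, y₀) ≤ (f x : EReal)) (h₀ : u (x₀, y₀) = (f x₀ : EReal)) :
    actJet (φ x₀) (jetAt f x₀) ∈ restrictModel '' S := by
  -- A quartic perturbation makes the contact strict, as the penalization requires, while its 2-jet
  -- at `x₀` is zero.
  let Q : V → ℝ := fun x => (‖x - x₀‖ ^ 2) ^ 2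
  have hQ : ContDiff ℝ 2 Q := ((contDiff_norm_sub_sq x₀).of_le two_le_infty).pow 2
  have hg : ContDiffAt ℝ 2 (f + Q) x₀ := hf.add hQ.contDiffAt
  have hjet : jetAt (f + Q) x₀ = jetAt f x₀ := by
    rw [jetAt_add hf hQ.contDiffAt, jetAt_quartic, add_zero]
  have hgx₀ : (f + Q) x₀ = f x₀ := congrArg Prod.fst hjet
  have hgev : ∀ᶠ x in 𝓝 x₀, ContDiffAt ℝ 2 (f + Q) x := hg.eventually (by simp)
  have hlt : ∀ᶠ x in 𝓝 x₀, x ≠ x₀ → u (x, y₀) < ((f + Q) x : ℝ) := by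
    filter_upwards [hle] with x hx hne
    refine hx.trans_lt (EReal.coe_lt_coe_iff.2 ?_)
    have : 0 < ‖x - x₀‖ := norm_pos_iff.2 (sub_ne_zero.2 hne)
    have : 0 < (‖x - x₀‖ ^ 2) ^ 2 := by positivity
    simpa [Q] using this
  obtain ⟨z, N, r, hz, hr, hN, hNz, hmax⟩ := exists_seq_penalized_max hD hu hu' hz₀
    (hgev.mono fun x hx => hx.continuousAt) hlt (by rw [h₀, hgx₀])
  have hz1 : Tendsto (fun k => (z k).1) atTop (𝓝 x₀) := (continuous_fst.tendsto _).comp hz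
  have hjlim : Tendsto (fun k => (jetAt (f + Q) (z k).1).2) atTop (𝓝 (jetAt f x₀).2) := by
    rw [← hjet]
    exact (continuous_snd.tendsto _).comp ((continuousAt_jetAt hg).tendsto.comp hz1)
  have hred : ∀ x, (x, y₀) ∈ D → ∀ j, restrictRed (Φ (x, y₀) j) = φ x (restrictRed j) :=
    fun x hx j => congrArg Prod.snd (hΦφ x hx (0, j))
  have hlim := hr.prodMk_nhds (tendsto_restrictRed hD hΦ hred hz₀ hz hN hNz hjlim)
  rw [hgx₀] at hlim
  -- Closedness of `i* S` is essential: the approximating jets lie in it, but their lifts in `S`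
  -- need not converge because `N` may blow up.
  refine hS.mem_of_tendsto hlim ?_
  filter_upwards [hmax, hz1.eventually hgev] with k ⟨hkD, hur, hkmax⟩ hkg
  -- The shift that brings the penalized function into contact with `u` at `z k`.
  let c : ℝ := r k - ((f + Q) (z k).1 + N k * ‖(z k).2 - y₀‖ ^ 2)
  let ψ : V × W → ℝ := fun w => (f + Q) w.1 + (c + N k * ‖w.2 - y₀‖ ^ 2)
  have hψz : ψ (z k) = r k := by
    simp only [ψ, c]
    ring
  have hψ : ContDiffAt ℝ 2 ψ (z k) := by
    have h1 : ContDiffAt ℝ 2 (fun w : V × W => (f + Q) w.1) (z k) := hkg.comp (z k) contDiffAt_fst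
    have h2 : ContDiff ℝ 2 (fun w : V × W => ‖w.2 - y₀‖ ^ 2) :=
      (((contDiff_norm_sub_sq y₀).of_le two_le_infty)).comp contDiff_snd
    exact h1.add (contDiffAt_const.add (contDiffAt_const.mul h2.contDiffAt))
  have hmem := hsub (z k) hkD ψ hψ (by
    filter_upwards [hkmax] with w hw
    refine hw.trans (le_of_eq (congrArg _ ?_))
    simp only [ψ, c]
    ring) (by rw [hur, hψz])
  have hj : jetAt ψ (z k) = _ := jetAt_penalized c (N k) y₀ hkg
  rw [hj] at hmem
  refine ⟨_, hmem, ?_⟩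
  rw [restrictModel_eq]
  exact Prod.ext hψz rfl

end LocalRestriction

/-! ### The restriction theorem on manifolds. -/

section Restriction

variable {E₁ E₂ : Type*} [NormedAddCommGroup E₁] [NormedSpace ℝ E₁]
  [NormedAddCommGroup E₂] [NormedSpace ℝ E₂]
  {X Z : Type*} [TopologicalSpace X] [ChartedSpace E₁ X] [TopologicalSpace Z] [ChartedSpace E₂ Z]
  [IsManifold 𝓘(ℝ, E₁) ∞ X] [IsManifold 𝓘(ℝ, E₂) ∞ Z]
  {V W : Type*} [NormedAddCommGroup V] [InnerProductSpace ℝ V] [FiniteDimensional ℝ V]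
  [NormedAddCommGroup W] [InnerProductSpace ℝ W] [FiniteDimensional ℝ W]
  {i : X → Z}

theorem IsSubharmonic.restrict (hi : Manifold.IsSmoothEmbedding 𝓘(ℝ, E₁) 𝓘(ℝ, E₂) ∞ i)
    {F : Set (JetBundle E₂ Z)} {S : Set (JetModel (V × W))}
    (hFS : LocallyJetEquivalentModulo i F S) (hclosed : IsClosed (restrictModel '' S))
    {u : Z → EReal} (hu : IsSubharmonic F u) :
    IsSubharmonic (restrictSet i hi.contMDiff F) (u ∘ i) := by
  obtain ⟨husc, htop, htest⟩ := hu
  refine ⟨husc.comp hi.contMDiff.continuous, fun x => htop _, fun x₀ f hf hle heq => ?_⟩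
  obtain ⟨e, y₀, hx₀, he, Φ, ⟨hΦ, φ, -, hΦφ⟩, hF⟩ := hFS x₀
  let c := he.sliceCoord hi x₀
  have hx₀c : x₀ ∈ c.toHomeo.source := hx₀
  have ht : c.toHomeo x₀ ∈ c.toHomeo.target := c.toHomeo.map_source hx₀c
  have hinv : x₀ = c.toHomeo.symm (c.toHomeo x₀) := (c.toHomeo.left_inv hx₀c).symm
  have hpt : ∀ v ∈ c.toHomeo.target, i (c.toHomeo.symm v) = e.toHomeo.symm (v, y₀) :=
    fun v hv => he.map_slicePoint x₀ hv
  rw [jet_congr_point hinv]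
  have hf' : ContMDiffAt 𝓘(ℝ, E₁) 𝓘(ℝ, ℝ) 2 f (c.toHomeo.symm (c.toHomeo x₀)) := hinv ▸ hf
  refine (c.jet_mem_iff ⟨_, ht⟩ hf').2 ?_
  refine (he.mem_fibre_restrictSet_iff hi x₀ hΦφ hF ⟨_, ht⟩ _).2 ?_
  change actJet (φ (c.toHomeo x₀)) (jetAt (f ∘ c.toHomeo.symm) (c.toHomeo x₀)) ∈ _
  -- In adapted coordinates everything reduces to the model case on the coordinate image. What
  -- remains is to transfer semicontinuity, ambient test functions and the contact of `f` along the
  -- slice.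
  refine actJet_jetAt_mem_restrictModel e.toHomeo.open_target (u := u ∘ e.toHomeo.symm) ?_
    (fun z _ => htop _) hclosed hΦ hΦφ ?_ ht (c.contDiffAt_comp_symm ht hf') ?_ ?_
  · intro z hz a ha
    exact (e.toHomeo.continuousOn_symm z hz).eventually (husc _ a ha)
  · intro z hz ψ hψ hψle hψz
    have hs := e.toHomeo.map_target hz
    have hri := e.toHomeo.right_inv hz
    have hC : ContMDiffAt 𝓘(ℝ, E₂) 𝓘(ℝ, ℝ) 2 (ψ ∘ e.toHomeo) (e.toHomeo.symm z) :=
      e.contMDiffAt_comp hs (by rwa [hri])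
    have hmem := htest (e.toHomeo.symm z) (ψ ∘ e.toHomeo) hC ?_ ?_
    · have h := (hF ⟨z, hz⟩ _).1 ((e.jet_mem_iff ⟨z, hz⟩ hC).1 hmem)
      have hev : (ψ ∘ e.toHomeo) ∘ e.toHomeo.symm =ᶠ[𝓝 z] ψ := by
        filter_upwards [e.toHomeo.open_target.mem_nhds hz] with w hw
        simp [e.toHomeo.right_inv hw]
      rwa [jetAt_congr hev] at h
    · have hcont := e.toHomeo.continuousAt hs
      rw [ContinuousAt, hri] at hcont
      filter_upwards [hcont.eventually hψle, e.toHomeo.open_source.mem_nhds hs] with w hw hw'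
      simpa [e.toHomeo.left_inv hw'] using hw
    · simpa [hri] using hψz
  · have hcont := c.toHomeo.continuousAt_symm ht
    rw [ContinuousAt, ← hinv] at hcont
    filter_upwards [hcont.eventually hle, c.toHomeo.open_target.mem_nhds ht] with v hv hv'
    simpa [hpt v hv'] using hv
  · have h1 : e.toHomeo.symm (c.toHomeo x₀, y₀) = i x₀ := by rw [← hpt _ ht, ← hinv]
    simp only [Function.comp_apply, h1, ← hinv]
    exact heq
end Restriction

end JetRestriction

end

open JetRestriction in
theorem theorem10p1 {n m : ℕ}
    {X : Type*} [TopologicalSpace X] [ChartedSpace (EuclideanSpace ℝ (Fin n)) X]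
    [IsManifold 𝓘(ℝ, EuclideanSpace ℝ (Fin n)) ∞ X]
    {Z : Type*} [TopologicalSpace Z] [ChartedSpace (EuclideanSpace ℝ (Fin (n + m))) Z]
    [IsManifold 𝓘(ℝ, EuclideanSpace ℝ (Fin (n + m))) ∞ Z]
    (i : X → Z)
    (hi : Manifold.IsSmoothEmbedding 𝓘(ℝ, EuclideanSpace ℝ (Fin n))
      𝓘(ℝ, EuclideanSpace ℝ (Fin (n + m))) ∞ i)
    (F : Set (JetBundle (EuclideanSpace ℝ (Fin (n + m))) Z)) (hF : IsSubequation F)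
    (S : Set (JetModel (EuclideanSpace ℝ (Fin n) × EuclideanSpace ℝ (Fin m))))
    (hS : IsConstSubequation S)
    (hFS : LocallyJetEquivalentModulo i F S)
    (hclosed : IsClosed (restrictModel '' S)) :
    IsConstSubequation (restrictModel '' S) ∧
    IsSubequation (restrictSet i hi.contMDiff F) ∧
    LocallyJetEquivalent (restrictSet i hi.contMDiff F) (restrictModel '' S) ∧
    ∀ u : Z → EReal, IsSubharmonic F u →
      IsSubharmonic (restrictSet i hi.contMDiff F) (u ∘ i) := by
  have hH : IsConstSubequation (restrictModel '' S) := ⟨hclosed, hS.2.restrictModel⟩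
  have hloc := locallyJetEquivalent_restrictSet hi hFS
  exact ⟨hH, hloc.isSubequation hH, hloc, fun u hu => hu.restrict hi hFS hclosed⟩
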